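/- Let $\Sigma$ be a closed connected oriented surface of genus $g\ge 0$, let $\Lambda$ be a free abelian group of finite rank, $\mathfrak t=\Lambda\otimes\mathbb R$, and let $K:\Lambda\times\Lambda\to\mathbb Z$ be an even, nondegenerate symmetric bilinear form; denote its real extension to $\mathfrak t$ also by $K$. Put $\Lambda^*=\operatorname{Hom}(\Lambda,\mathbb Z)$, $K\Lambda=\{K(x,\cdot):x\in\Lambda\}\subset\Lambda^*$ and $G_K=\Lambda^*/K\Lambda$. Let $\mathcal M=H^1(\Sigma;\mathfrak t)/H^1(\Sigma;\Lambda)$ with the symplectic form $\omega(v,w)=\int_\Sigma K(v\wedge w)$. A prequantum line bundle on $\mathcal M$ is a quotient, by a lift of the translation action of $H^1(\Sigma;\Lambda)$ preserving metric and connection, of the trivial Hermitian line bundle over $H^1(\Sigma;\mathfrak t)$ with connection $d+\alpha$, $\alpha_v(w)=-\pi i\,\omega(v,w)$ (so its curvature is $-2\pi i\,\omega$). The canonical one is given by the lift $l\cdot(v,z)=(v+l,\ \varepsilon(l)e^{\pi i\omega(l,v)}z)$, where $\varepsilon:H^1(\Sigma;\Lambda)\to\{\pm1\}$ is the unique function with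 $\varepsilon(l+m)=\varepsilon(l)\varepsilon(m)(-1)^{\omega(l,m)}$ and $\varepsilon(c\otimes x)=1$ for $c\in H^1(\Sigma;\mathbb Z)$, $x\in\Lambda$. Let $L\subset H^1(\Sigma;\mathbb R)$ be a rational subspace that is Lagrangian for the cup-product form. The leaves of the polarization $L\otimes\mathfrak t\subset H^1(\Sigma;\mathfrak t)$ are the translates in $\mathcal M$ of the image of $L\otimes\mathfrak t$; they are the elements of the group $\mathcal M/(L\otimes\mathfrak t)$. A leaf is Bohr--Sommerfeld for a prequantum line bundle if the bundle has a nowhere vanishing covariantly constant section over it (equivalently, trivial holonomy along it); let $\mathcal{BS}$ be the set of these leaves. Then there is a symplectic basis $(a_1,\dots,a_g,b_1,\dots,b_g)$ of $H^1(\Sigma;\mathbb Z)$ with $L=\operatorname{span}_{\mathbb R}\{a_1,\dots,a_g\}$. For every prequantum line bundle on $\mathcal M$, in particular for the canonical one, and every such basis, the rule $([u_1],\dots,[u_g])\mapsto \bigl[\sum_j b_j\otimes K^{-1}u_j\bigr]$, where $K^{-1}u\in\mathfrak t$ is the element with $K(K^{-1}u,\cdot)=u$ on $\Lambda$, is a well-defined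 homomorphism from $G_K^g=(\Lambda^*/K\Lambda)^g$ to $\mathcal M/(L\otimes\mathfrak t)$, and $\mathcal{BS}$ is a torsor for $G_K^g$ acting by the corresponding translations. Consequently $\mathcal{BS}$ is finite and $$\#\mathcal{BS}=|G_K|^g=|\det K|^g,$$ where $\det K$ is the determinant of the Gram matrix of $K$ in a $\mathbb Z$-basis of $\Lambda$. For the canonical bundle, the leaf through the origin is Bohr--Sommerfeld. -/

import Mathlib

open scoped TensorProduct

noncomputable section

namespace ToralCS

/-! ### Closed oriented surfaces and their first cohomology -/

/-- A closed connected oriented surface, given by a finite collection `T` of oriented triangles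
whose sides `(t, 0), (t, 1), (t, 2)` (listed in the positive cyclic order) are glued in pairs by
orientation-reversing identifications.  Every such gluing is a closed oriented surface, and every
closed connected oriented surface is obtained in this way from a triangulation. -/
structure Surface (T : Type*) where
  /-- the side to which a given side is glued -/
  glue : T × ZMod 3 → T × ZMod 3
  glue_glue : ∀ s, glue (glue s) = s
  glue_ne : ∀ s, glue s ≠ s
  nonempty : Nonempty T
  /-- any two triangles are joined by a chain of triangles glued along sides -/
  connected : ∀ t t' : T,
    Relation.ReflTransGen (fun t₁ t₂ => ∃ i, (glue (t₁, i)).1 = t₂) t t'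

/-- The next side of the same triangle, in the positive direction. -/
def next {T : Type*} (s : T × ZMod 3) : T × ZMod 3 := (s.1, s.2 + 1)

namespace Surface

variable {T : Type*} (S : Surface T)

/-- Vertices: two sides have the same initial vertex iff they are related by repeatedly going
from `s` to the successor of the side glued to `s`. -/
def Vertex : Type _ := Quot (fun s s' : T × ZMod 3 => s' = next (S.glue s))

/-- Edges: sides up to gluing. -/
def Edge : Type _ := Quot (fun s s' : T × ZMod 3 => s' = S.glue s)

/-- The initial vertex of a side. -/
def origin (s : T × ZMod 3) : S.Vertex := Quot.mk _ s

/-- The final vertex of a side. -/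
def tip (s : T × ZMod 3) : S.Vertex := S.origin (next s)

/-- `V - E + F`. -/
def eulerChar : ℤ := (Nat.card S.Vertex : ℤ) - Nat.card S.Edge + Nat.card T

/-- The connected surface `S` has genus `g`. -/
def HasGenus (g : ℕ) : Prop := S.eulerChar = 2 - 2 * (g : ℤ)

theorem origin_glue (s : T × ZMod 3) : S.origin (S.glue s) = S.tip s := by
  have h : S.origin (S.glue s) = S.origin (next (S.glue (S.glue s))) := Quot.sound rfl
  rwa [S.glue_glue] at h

theorem tip_glue (s : T × ZMod 3) : S.tip (S.glue s) = S.origin s :=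
  (Quot.sound rfl : S.origin s = S.origin (next (S.glue s))).symm

section Cohomology

variable (R : Type*) [CommRing R] (A : Type*) [AddCommGroup A] [Module R A]

/-- Cellular `1`-cocycles with values in `A`: a cochain is a function on oriented edges, odd under
reversal of the edge; it is closed if it sums to zero around each triangle. -/
def cocycles : Submodule R (T × ZMod 3 → A) where
  carrier := {f | (∀ s, f (S.glue s) = -f s) ∧ ∀ t, f (t, 0) + f (t, 1) + f (t, 2) = 0}
  zero_mem' := by simp
  add_mem' := by
    rintro f g ⟨hf, hf'⟩ ⟨hg, hg'⟩
    refine ⟨fun s => ?_, fun t => ?_⟩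
    · simp only [Pi.add_apply, hf, hg]; abel
    · have := congrArg₂ (· + ·) (hf' t) (hg' t)
      simp only [add_zero] at this
      rw [← this]; simp only [Pi.add_apply]; abel
  smul_mem' := by
    rintro c f ⟨hf, hf'⟩
    refine ⟨fun s => ?_, fun t => ?_⟩
    · simp [hf]
    · simp only [Pi.smul_apply, ← smul_add, hf', smul_zero]

/-- The coboundary of a `0`-cochain. -/
def coboundary : (S.Vertex → A) →ₗ[R] S.cocycles R A where
  toFun h := ⟨fun s => h (S.tip s) - h (S.origin s), by
    refine ⟨fun s => ?_, fun t => ?_⟩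
    · simp only [S.tip_glue, S.origin_glue]; abel
    · have h0 : S.tip (t, 0) = S.origin (t, 1) := by simp [tip, next]
      have h1 : S.tip (t, 1) = S.origin (t, 2) := by
        simp only [tip, next]; rfl
      have h2 : S.tip (t, 2) = S.origin (t, 0) := by
        simp only [tip, next]; rfl
      change h (S.tip (t, 0)) - h (S.origin (t, 0)) + (h (S.tip (t, 1)) - h (S.origin (t, 1))) +
        (h (S.tip (t, 2)) - h (S.origin (t, 2))) = 0
      rw [h0, h1, h2]
      abel⟩
  map_add' h h' := by ext s; simp only [Pi.add_apply, Submodule.coe_add]; abel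
  map_smul' c h := by
    ext s; simp only [Pi.smul_apply, Submodule.coe_smul, RingHom.id_apply, smul_sub]

/-- `H¹(S; A)`. -/
abbrev H1 : Type _ := S.cocycles R A ⧸ LinearMap.range (S.coboundary R A)

/-- The class of a cocycle. -/
abbrev cls : S.cocycles R A →ₗ[R] S.H1 R A := (LinearMap.range (S.coboundary R A)).mkQ

end Cohomology

section Functoriality

variable {R R' : Type*} [CommRing R] [CommRing R'] {σ : R →+* R'}
  {A B : Type*} [AddCommGroup A] [Module R A] [AddCommGroup B] [Module R' B]

/-- Change of coefficients on cocycles. -/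
def mapCocycles (f : A →ₛₗ[σ] B) : S.cocycles R A →ₛₗ[σ] S.cocycles R' B where
  toFun c := ⟨fun s => f (c.1 s), fun s => by
    change f (c.1 (S.glue s)) = -f (c.1 s)
    rw [c.2.1, map_neg],
    fun t => by
    change f (c.1 (t, 0)) + f (c.1 (t, 1)) + f (c.1 (t, 2)) = 0
    rw [← map_add, ← map_add, c.2.2, map_zero]⟩
  map_add' c c' := by ext s; simp
  map_smul' r c := by ext s; simp

/-- Change of coefficients `H¹(S; A) → H¹(S; B)`. -/
def mapH1 (f : A →ₛₗ[σ] B) : S.H1 R A →ₛₗ[σ] S.H1 R' B :=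
  Submodule.mapQ _ _ (S.mapCocycles f) (by
    rintro _ ⟨h, rfl⟩
    refine ⟨fun v => f (h v), ?_⟩
    ext s
    simp [mapCocycles, coboundary])

end Functoriality

section Pairing

variable [Fintype T] {A : Type*} [AddCommGroup A] [Module ℝ A]

theorem sum_odd (F : T × ZMod 3 → ℝ) (hF : ∀ s, F (S.glue s) = -F s) : ∑ s, F s = 0 := by
  have h : ∑ s, F (S.glue s) = ∑ s, F s :=
    Equiv.sum_comp (Function.Involutive.toPerm S.glue S.glue_glue) F
  simp only [hF, Finset.sum_neg_distrib] at h
  linarith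

/-- `∫_S β(a ∧ b)` on cocycles.  A cocycle is represented by the `A`-valued `1`-form that is
constant on each affine triangle and has the prescribed integrals over the sides; the integral of
`β(a ∧ b)` over a triangle with consecutive sides `e₀, e₁` is then
`(β(a(e₀), b(e₁)) - β(a(e₁), b(e₀))) / 2`. -/
def pairingCocycles (β : LinearMap.BilinForm ℝ A) :
    LinearMap.BilinForm ℝ (S.cocycles ℝ A) :=
  LinearMap.mk₂ ℝ (fun a b => ∑ t : T,
      (β (a.1 (t, 0)) (b.1 (t, 1)) - β (a.1 (t, 1)) (b.1 (t, 0))) / 2)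
    (fun a a' b => by
      rw [← Finset.sum_add_distrib]; refine Finset.sum_congr rfl fun t _ => ?_
      simp only [Submodule.coe_add, Pi.add_apply, map_add, LinearMap.add_apply]; ring)
    (fun c a b => by
      rw [Finset.smul_sum]; refine Finset.sum_congr rfl fun t _ => ?_
      simp only [Submodule.coe_smul, Pi.smul_apply, map_smul, LinearMap.smul_apply,
        smul_eq_mul]; ring)
    (fun a b b' => by
      rw [← Finset.sum_add_distrib]; refine Finset.sum_congr rfl fun t _ => ?_
      simp only [Submodule.coe_add, Pi.add_apply, map_add]; ring)
    (fun c a b => by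
      rw [Finset.smul_sum]; refine Finset.sum_congr rfl fun t _ => ?_
      simp only [Submodule.coe_smul, Pi.smul_apply, map_smul, smul_eq_mul]; ring)

theorem pairingCocycles_apply (β : LinearMap.BilinForm ℝ A) (a b : S.cocycles ℝ A) :
    S.pairingCocycles β a b = ∑ t : T,
      (β (a.1 (t, 0)) (b.1 (t, 1)) - β (a.1 (t, 1)) (b.1 (t, 0))) / 2 := rfl

theorem pairingCocycles_flip (β : LinearMap.BilinForm ℝ A) (a b : S.cocycles ℝ A) :
    S.pairingCocycles β a b = -S.pairingCocycles β.flip b a := by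
  rw [pairingCocycles_apply, pairingCocycles_apply, ← Finset.sum_neg_distrib]
  refine Finset.sum_congr rfl fun t _ => ?_
  simp only [LinearMap.BilinForm.flip_apply]; ring

theorem sum_sides (F : T × ZMod 3 → ℝ) :
    ∑ s, F s = ∑ t, (F (t, 0) + F (t, 1) + F (t, 2)) := by
  rw [Fintype.sum_prod_type]
  exact Finset.sum_congr rfl fun t _ => Fin.sum_univ_three (fun i : Fin 3 => F (t, i))

theorem pairingCocycles_coboundary (β : LinearMap.BilinForm ℝ A) (h : S.Vertex → A)
    (b : S.cocycles ℝ A) : S.pairingCocycles β (S.coboundary ℝ A h) b = 0 := by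
  have key := S.sum_odd (fun s => β (h (S.origin s) + h (S.tip s)) (b.1 s)) (fun s => by
    rw [S.origin_glue, S.tip_glue, b.2.1, map_neg, add_comm])
  rw [sum_sides] at key
  have key2 : S.pairingCocycles β (S.coboundary ℝ A h) b = (∑ t,
      (β (h (S.origin (t, 0)) + h (S.tip (t, 0))) (b.1 (t, 0)) +
        β (h (S.origin (t, 1)) + h (S.tip (t, 1))) (b.1 (t, 1)) +
        β (h (S.origin (t, 2)) + h (S.tip (t, 2))) (b.1 (t, 2)))) / 2 := by
    rw [pairingCocycles_apply, Finset.sum_div]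
    refine Finset.sum_congr rfl fun t _ => ?_
    have h0 : S.tip (t, 0) = S.origin (t, 1) := by simp [tip, next]
    have h1 : S.tip (t, 1) = S.origin (t, 2) := by
      simp only [tip, next]; rfl
    have h2 : S.tip (t, 2) = S.origin (t, 0) := by
      simp only [tip, next]; rfl
    have hb : b.1 (t, 2) = -(b.1 (t, 0) + b.1 (t, 1)) :=
      eq_neg_of_add_eq_zero_right (b.2.2 t)
    rw [hb, h0, h1, h2]
    simp only [coboundary, LinearMap.coe_mk, AddHom.coe_mk, h0, h1, map_add, map_sub, map_neg,
      LinearMap.add_apply, LinearMap.sub_apply]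
    ring
  rw [key2, key, zero_div]

/-- `(a, b) ↦ ∫_S β(a ∧ b)` on `H¹(S; A)`. -/
def pairing (β : LinearMap.BilinForm ℝ A) : LinearMap.BilinForm ℝ (S.H1 ℝ A) :=
  Submodule.liftQ _
    ((LinearMap.range (S.coboundary ℝ A)).liftQ (S.pairingCocycles β).flip (by
      rintro _ ⟨h, rfl⟩
      ext b
      change S.pairingCocycles β b (S.coboundary ℝ A h) = 0
      rw [pairingCocycles_flip, pairingCocycles_coboundary, neg_zero])).flip (by
      rintro _ ⟨h, rfl⟩
      ext b
      exact S.pairingCocycles_coboundary β h b)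

theorem pairing_cls (β : LinearMap.BilinForm ℝ A) (a b : S.cocycles ℝ A) :
    S.pairing β (S.cls ℝ A a) (S.cls ℝ A b) = S.pairingCocycles β a b := rfl

/-- The cup-product symplectic form on `H¹(S; ℝ)`. -/
def cup : LinearMap.BilinForm ℝ (S.H1 ℝ ℝ) := S.pairing (LinearMap.mul ℝ ℝ)

end Pairing

/-- `H¹(S; ℤ) → H¹(S; ℝ)`. -/
def integral : S.H1 ℤ ℤ →ₛₗ[Int.castRingHom ℝ] S.H1 ℝ ℝ :=
  S.mapH1 (Int.castRingHom ℝ).toSemilinearMap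

/-- `L` is spanned by integral classes. -/
def IsRational (L : Submodule ℝ (S.H1 ℝ ℝ)) : Prop :=
  L = Submodule.span ℝ ((L : Set (S.H1 ℝ ℝ)) ∩ Set.range S.integral)

/-- `L` equals its orthogonal complement for the cup-product form. -/
def IsLagrangian [Fintype T] (L : Submodule ℝ (S.H1 ℝ ℝ)) : Prop :=
  ∀ c, c ∈ L ↔ ∀ d ∈ L, S.cup c d = 0

/-- `(a₁, …, a_g, b₁, …, b_g)` is a symplectic `ℤ`-basis of `H¹(S; ℤ)` and
`L = span_ℝ {a₁, …, a_g}`. -/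
structure IsAdaptedBasis [Fintype T] (L : Submodule ℝ (S.H1 ℝ ℝ)) {g : ℕ}
    (a b : Fin g → S.H1 ℤ ℤ) : Prop where
  linearIndependent : LinearIndependent ℤ (Sum.elim a b)
  span_eq_top : Submodule.span ℤ (Set.range (Sum.elim a b)) = ⊤
  cup_a_a : ∀ i j, S.cup (S.integral (a i)) (S.integral (a j)) = 0
  cup_b_b : ∀ i j, S.cup (S.integral (b i)) (S.integral (b j)) = 0
  cup_a_b : ∀ i j, S.cup (S.integral (a i)) (S.integral (b j)) = if i = j then 1 else 0
  span_a : L = Submodule.span ℝ (Set.range fun i => S.integral (a i))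

end Surface

/-! ### The torus `𝔱/Λ` and the discriminant group -/

section Torus

variable (Λ : Type*) [AddCommGroup Λ]

/-- The Lie algebra `𝔱 = ℝ ⊗ Λ` of the torus `𝕋 = 𝔱/Λ`. -/
abbrev Lie : Type _ := ℝ ⊗[ℤ] Λ

/-- The inclusion `Λ → 𝔱`. -/
def incl : Λ →ₛₗ[Int.castRingHom ℝ] Lie Λ where
  toFun x := 1 ⊗ₜ x
  map_add' x y := TensorProduct.tmul_add _ _ _
  map_smul' n x := by
    simp [TensorProduct.tmul_smul, Int.cast_smul_eq_zsmul]

variable {Λ}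

/-- The real extension of an integral bilinear form to `𝔱`. -/
def realForm (K : LinearMap.BilinForm ℤ Λ) : LinearMap.BilinForm ℝ (Lie Λ) :=
  LinearMap.BilinForm.baseChange ℝ K

theorem realForm_incl (K : LinearMap.BilinForm ℤ Λ) (x y : Λ) :
    realForm K (incl Λ x) (incl Λ y) = K x y := by
  simp [realForm, incl, LinearMap.BilinForm.baseChange_tmul]

/-- `G_K = Λ*/KΛ`. -/
abbrev Discriminant (K : LinearMap.BilinForm ℤ Λ) : Type _ :=
  Module.Dual ℤ Λ ⧸ LinearMap.range (K : Λ →ₗ[ℤ] Module.Dual ℤ Λ)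

end Torus

/-! ### The moduli torus, its polarization and its prequantum line bundles -/

namespace Surface

variable {T : Type*} (S : Surface T) {Λ : Type*} [AddCommGroup Λ]

variable (Λ) in
/-- The natural map `H¹(S; Λ) → H¹(S; 𝔱)`. -/
def lattice : S.H1 ℤ Λ →ₛₗ[Int.castRingHom ℝ] S.H1 ℝ (Lie Λ) := S.mapH1 (incl Λ)

/-- `c ⊗ x ∈ H¹(S; 𝔱)` for `c ∈ H¹(S; ℝ)` and `x ∈ 𝔱`. -/
def tensor (c : S.H1 ℝ ℝ) (x : Lie Λ) : S.H1 ℝ (Lie Λ) :=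
  S.mapH1 (LinearMap.toSpanSingleton ℝ (Lie Λ) x) c

variable (Λ) in
/-- The moduli torus `H¹(S; 𝔱)/H¹(S; Λ)`. -/
abbrev Moduli : Type _ := S.H1 ℝ (Lie Λ) ⧸ (S.lattice Λ).toAddMonoidHom.range

variable (Λ) in
/-- The polarization `L ⊗ 𝔱 ⊆ H¹(S; 𝔱)`. -/
def polarization (L : Submodule ℝ (S.H1 ℝ ℝ)) : Submodule ℝ (S.H1 ℝ (Lie Λ)) :=
  Submodule.span ℝ {v | ∃ c ∈ L, ∃ x : Lie Λ, v = S.tensor c x}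

variable (Λ) in
/-- The leaves of the polarization: the translates in the moduli torus of the image of
`L ⊗ 𝔱`. -/
abbrev Leaf (L : Submodule ℝ (S.H1 ℝ ℝ)) : Type _ :=
  S.Moduli Λ ⧸ (S.polarization Λ L).toAddSubgroup.map
    (QuotientAddGroup.mk' (S.lattice Λ).toAddMonoidHom.range)

/-- The leaf through the image of `v ∈ H¹(S; 𝔱)` in the moduli torus. -/
def leaf (L : Submodule ℝ (S.H1 ℝ ℝ)) (v : S.H1 ℝ (Lie Λ)) : S.Leaf Λ L :=
  QuotientAddGroup.mk (QuotientAddGroup.mk v : S.Moduli Λ)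

variable [Fintype T]

/-- The symplectic form `ω(v, w) = ∫_S K(v ∧ w)` on `H¹(S; 𝔱)`. -/
def omega (K : LinearMap.BilinForm ℤ Λ) : LinearMap.BilinForm ℝ (S.H1 ℝ (Lie Λ)) :=
  S.pairing (realForm K)

/-- The connection form `α_v(w) = -π i ∫_S K(v ∧ w)` on `H¹(S; 𝔱)`; the connection is
`∇ = d + α`, and its curvature is `dα = -2π i ω`. -/
def connection (K : LinearMap.BilinForm ℤ Λ) (v w : S.H1 ℝ (Lie Λ)) : ℂ :=
  -(Real.pi * Complex.I * (S.omega K v w : ℝ))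

/-- A prequantum line bundle on the moduli torus: the Hermitian line bundle with connection
`d + α` on `H¹(S; 𝔱)` together with a lift
`(v, z) ↦ (v + l, mult l v * z)` of the translation action of the lattice `H¹(S; Λ)` that
preserves the Hermitian metric and the connection.  The bundle on the moduli torus is the
quotient of `H¹(S; 𝔱) × ℂ` by this action. -/
structure Prequantum (K : LinearMap.BilinForm ℤ Λ) where
  mult : S.H1 ℤ Λ → S.H1 ℝ (Lie Λ) → ℂ
  norm_mult : ∀ l v, ‖mult l v‖ = 1
  mult_add : ∀ l m v, mult (l + m) v = mult l (v + S.lattice Λ m) * mult m v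
  hasDerivAt_mult : ∀ l v w, HasDerivAt (fun r : ℝ => mult l (v + r • w))
    ((S.connection K v w - S.connection K (v + S.lattice Λ l) w) * mult l v) 0

/-- A leaf is Bohr--Sommerfeld if the prequantum bundle has a nowhere vanishing covariantly
constant section over it, i.e. if its leafwise holonomy is trivial.  A section over a leaf is a
function on the inverse image of the leaf in `H¹(S; 𝔱)` that is equivariant under the lattice. -/
def bohrSommerfeld {K : LinearMap.BilinForm ℤ Λ} (P : S.Prequantum K)
    (L : Submodule ℝ (S.H1 ℝ ℝ)) : Set (S.Leaf Λ L) :=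
  {ℓ | ∃ s : S.H1 ℝ (Lie Λ) → ℂ, ∀ v, S.leaf L v = ℓ →
    s v ≠ 0 ∧
    (∀ l, s (v + S.lattice Λ l) = P.mult l v * s v) ∧
    ∀ w ∈ S.polarization Λ L,
      HasDerivAt (fun r : ℝ => s (v + r • w)) (-(S.connection K v w) * s v) 0}

/-! ### The canonical prequantum line bundle -/

theorem pairing_flip {A : Type*} [AddCommGroup A] [Module ℝ A] (β : LinearMap.BilinForm ℝ A)
    (a b : S.H1 ℝ A) : S.pairing β a b = -S.pairing β.flip b a := by
  obtain ⟨a, rfl⟩ := Submodule.mkQ_surjective _ a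
  obtain ⟨b, rfl⟩ := Submodule.mkQ_surjective _ b
  exact S.pairingCocycles_flip β a b

theorem even_sum_even (F : T × ZMod 3 → ℤ) (hF : ∀ s, F (S.glue s) = F s) :
    Even (∑ s, F s) := by
  rw [even_iff_two_dvd]
  refine (ZMod.intCast_zmod_eq_zero_iff_dvd _ 2).1 ?_
  rw [Int.cast_sum]
  refine Finset.sum_involution (fun s _ => S.glue s) (fun s _ => ?_)
    (fun s _ _ => S.glue_ne s) (fun s _ => Finset.mem_univ _) (fun s _ => S.glue_glue s)
  rw [hF]
  exact CharTwo.add_self_eq_zero _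

/-- An integral bilinear form on `Λ` induces an integral form on `H¹(S; Λ)`. -/
theorem exists_int_pairing (B : LinearMap.BilinForm ℤ Λ) (l m : S.H1 ℤ Λ) :
    ∃ n : ℤ, S.omega B (S.lattice Λ l) (S.lattice Λ m) = n := by
  obtain ⟨l, rfl⟩ := Submodule.mkQ_surjective _ l
  obtain ⟨m, rfl⟩ := Submodule.mkQ_surjective _ m
  have h := S.even_sum_even (fun s => B (l.1 s) (m.1 s)) (fun s => by
    rw [l.2.1, m.2.1]; simp)
  rw [Fintype.sum_prod_type] at h
  have h' : Even (∑ t, (B (l.1 (t, 0)) (m.1 (t, 1)) - B (l.1 (t, 1)) (m.1 (t, 0)))) := by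
    have e : ∑ t, (B (l.1 (t, 0)) (m.1 (t, 1)) - B (l.1 (t, 1)) (m.1 (t, 0))) =
        (∑ t, ∑ i : ZMod 3, B (l.1 (t, i)) (m.1 (t, i))) -
        2 * ∑ t, (B (l.1 (t, 0)) (m.1 (t, 0)) + B (l.1 (t, 1)) (m.1 (t, 1)) +
          B (l.1 (t, 1)) (m.1 (t, 0))) := by
      rw [Finset.mul_sum, ← Finset.sum_sub_distrib]
      refine Finset.sum_congr rfl fun t _ => ?_
      have e3 : ∑ i : ZMod 3, B (l.1 (t, i)) (m.1 (t, i)) =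
          B (l.1 (t, 0)) (m.1 (t, 0)) + B (l.1 (t, 1)) (m.1 (t, 1)) +
          B (l.1 (t, 2)) (m.1 (t, 2)) :=
        Fin.sum_univ_three (fun i : Fin 3 => B (l.1 (t, i)) (m.1 (t, i)))
      have hl : l.1 (t, 2) = -(l.1 (t, 0) + l.1 (t, 1)) :=
        eq_neg_of_add_eq_zero_right (l.2.2 t)
      have hm : m.1 (t, 2) = -(m.1 (t, 0) + m.1 (t, 1)) :=
        eq_neg_of_add_eq_zero_right (m.2.2 t)
      rw [e3, hl, hm]
      simp only [map_neg, map_add, LinearMap.neg_apply, LinearMap.add_apply]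
      ring
    rw [e]
    exact h.sub (even_two_mul _)
  obtain ⟨n, hn⟩ := h'
  refine ⟨n, ?_⟩
  have e : S.omega B (S.lattice Λ (S.cls ℤ Λ l)) (S.lattice Λ (S.cls ℤ Λ m)) =
      (((∑ t, (B (l.1 (t, 0)) (m.1 (t, 1)) - B (l.1 (t, 1)) (m.1 (t, 0))) : ℤ) : ℝ)) / 2 := by
    change S.pairingCocycles (realForm B) (S.mapCocycles (incl Λ) l)
      (S.mapCocycles (incl Λ) m) = _
    rw [pairingCocycles_apply, Int.cast_sum, Finset.sum_div]
    refine Finset.sum_congr rfl fun t _ => ?_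
    simp [mapCocycles, realForm_incl]
  change S.omega B (S.lattice Λ (S.cls ℤ Λ l)) (S.lattice Λ (S.cls ℤ Λ m)) = _
  rw [e, hn]; push_cast; ring

theorem omega_add_flip (B K : LinearMap.BilinForm ℤ Λ) (h : ∀ x y, K x y = B x y + B y x)
    (v w : S.H1 ℝ (Lie Λ)) : S.omega K v w = S.omega B v w - S.omega B w v := by
  have hK : realForm K = realForm B + (realForm B).flip := by
    have e : ∀ x y : Λ, ∀ r q : ℝ, realForm K (r ⊗ₜ x) (q ⊗ₜ y) =
        (realForm B + (realForm B).flip) (r ⊗ₜ x) (q ⊗ₜ y) := by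
      intro x y r q
      simp [realForm, LinearMap.BilinForm.baseChange_tmul, h]
      ring
    refine LinearMap.ext fun x => LinearMap.ext fun y => ?_
    induction x using TensorProduct.induction_on with
    | zero => simp
    | add x x' hx hx' => rw [map_add, map_add, LinearMap.add_apply, LinearMap.add_apply, hx, hx']
    | tmul r x =>
      induction y using TensorProduct.induction_on with
      | zero => simp
      | add y y' hy hy' => rw [map_add, map_add, hy, hy']
      | tmul q y => exact e x y r q
  obtain ⟨v, rfl⟩ := Submodule.mkQ_surjective _ v
  obtain ⟨w, rfl⟩ := Submodule.mkQ_surjective _ w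
  change S.pairingCocycles (realForm K) v w =
    S.pairingCocycles (realForm B) v w - S.pairingCocycles (realForm B) w v
  rw [S.pairingCocycles_flip (realForm B) w v, hK]
  simp only [pairingCocycles_apply, sub_neg_eq_add, ← Finset.sum_add_distrib]
  refine Finset.sum_congr rfl fun t _ => ?_
  simp only [LinearMap.add_apply, LinearMap.BilinForm.flip_apply]; ring

/-- The canonical prequantum line bundle attached to a splitting `K(x, y) = B(x, y) + B(y, x)`.
The lift of the lattice action is normalized to be `mult l v = ε(l) exp(π i ω(l, v))` with
`ε(l) = exp(π i ∫_S B(l ∧ l)) = ± 1`; equivalently, `ε(c ⊗ x) = 1` for all `c ∈ H¹(S; ℤ)` and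
`x ∈ Λ`, so that the bundle does not depend on the choice of `B`. -/
def prequantumOfSplitting (K B : LinearMap.BilinForm ℤ Λ)
    (h : ∀ x y, K x y = B x y + B y x) : S.Prequantum K where
  mult l v := Complex.exp (Real.pi * Complex.I *
    ((S.omega B (S.lattice Λ l) (S.lattice Λ l) + S.omega K (S.lattice Λ l) v : ℝ) : ℂ))
  norm_mult l v := by
    rw [Complex.norm_exp]; simp
  mult_add l m v := by
    rw [← Complex.exp_add, ← mul_add, ← Complex.ofReal_add, Complex.exp_eq_exp_iff_exists_int]
    obtain ⟨n, hn⟩ := S.exists_int_pairing B m l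
    refine ⟨n, ?_⟩
    have e : S.omega B (S.lattice Λ (l + m)) (S.lattice Λ (l + m)) +
          S.omega K (S.lattice Λ (l + m)) v =
        (S.omega B (S.lattice Λ l) (S.lattice Λ l) + S.omega K (S.lattice Λ l) (v + S.lattice Λ m) +
          (S.omega B (S.lattice Λ m) (S.lattice Λ m) + S.omega K (S.lattice Λ m) v)) + 2 * n := by
      rw [← hn]
      simp only [map_add, LinearMap.add_apply]
      rw [S.omega_add_flip B K h (S.lattice Λ l) (S.lattice Λ m)]
      ring
    rw [e]; push_cast; ring
  hasDerivAt_mult l v w := by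
    have e : ∀ r : ℝ, S.omega K (S.lattice Λ l) (v + r • w) =
        S.omega K (S.lattice Λ l) v + r * S.omega K (S.lattice Λ l) w := by
      intro r; simp
    have e2 : S.connection K v w - S.connection K (v + S.lattice Λ l) w =
        Real.pi * Complex.I * (S.omega K (S.lattice Λ l) w : ℝ) := by
      simp only [connection, map_add, LinearMap.add_apply]; push_cast; ring
    simp only [e]
    rw [e2]
    generalize S.omega B (S.lattice Λ l) (S.lattice Λ l) = p
    generalize S.omega K (S.lattice Λ l) v = q
    generalize S.omega K (S.lattice Λ l) w = c
    have h1 : HasDerivAt (fun r : ℝ => p + (q + r * c)) c 0 := by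
      simpa using (((hasDerivAt_id (0 : ℝ)).mul_const c).const_add q).const_add p
    have h2 := ((h1.ofReal_comp).const_mul (Real.pi * Complex.I : ℂ)).cexp
    refine h2.congr_deriv ?_
    simp only [zero_mul, add_zero]
    rw [mul_comm]

end Surface

/-- An even symmetric form is of the form `B(x, y) + B(y, x)`. -/
theorem exists_splitting {Λ : Type*} [AddCommGroup Λ] [Module.Free ℤ Λ] [Module.Finite ℤ Λ]
    (K : LinearMap.BilinForm ℤ Λ) (hsymm : ∀ x y, K x y = K y x) (heven : ∀ x, Even (K x x)) :
    ∃ B : LinearMap.BilinForm ℤ Λ, ∀ x y, K x y = B x y + B y x := by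
  let b := Module.finBasis ℤ Λ
  let M : Matrix (Fin (Module.finrank ℤ Λ)) (Fin (Module.finrank ℤ Λ)) ℤ := fun i j =>
    if i < j then K (b i) (b j) else if i = j then K (b i) (b j) / 2 else 0
  let B : LinearMap.BilinForm ℤ Λ := Matrix.toLinearMap₂ b b M
  have hB : ∀ i j, B (b i) (b j) = M i j := fun i j => by
    exact Matrix.toLinearMap₂_apply_basis b b M i j
  have hK : K = B + B.flip := by
    refine LinearMap.ext_basis b b fun i j => ?_
    simp only [LinearMap.add_apply, LinearMap.BilinForm.flip_apply, hB, M]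
    rcases lt_trichotomy i j with hij | rfl | hij
    · simp [hij, hij.not_gt, hij.ne']
    · obtain ⟨n, hn⟩ := heven (b i)
      simp only [lt_irrefl, if_false, if_true, hn]; omega
    · simp [hij, hij.not_gt, hij.ne', hsymm (b i) (b j)]
  exact ⟨B, fun x y => by rw [hK]; simp⟩

/-- The canonical prequantum line bundle of the moduli torus. -/
def Surface.canonicalPrequantum {T : Type*} [Fintype T] (S : Surface T)
    {Λ : Type*} [AddCommGroup Λ] [Module.Free ℤ Λ] [Module.Finite ℤ Λ]
    (K : LinearMap.BilinForm ℤ Λ) (hsymm : ∀ x y, K x y = K y x) (heven : ∀ x, Even (K x x)) :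
    S.Prequantum K :=
  S.prequantumOfSplitting K (exists_splitting K hsymm heven).choose
    (exists_splitting K hsymm heven).choose_spec

end ToralCS

end

/-! The polarization `L ⊗ 𝔱` is isotropic, so the connection is flat along each leaf and the only
obstruction to a covariantly constant section is holonomy along the lattice vectors in `L ⊗ 𝔱`. Over
the leaf through `v` it is trivial iff the multiplier of each such `l` at `v` equals `exp(π i ω(v,
l))` (`leaf_mem_bohrSommerfeld_iff`). In an adapted basis these `l` are the sums `∑ a_j ⊗ x_j` with
`x_j ∈ Λ`.

Replacing `v` by `v + w` multiplies the two sides by inverse phases, so a Bohr–Sommerfeld leaf stays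
one iff `ω(w, l) ∈ ℤ` for all these `l`. Modulo `L ⊗ 𝔱` one has `w = ∑ b_j ⊗ y_j`, and the condition
says `K(y_j, ·) ∈ Λ*`. Translation by the lattice absorbs `y_j ∈ Λ`, that is `K(y_j, ·) ∈ KΛ`,
leaving exactly `G_K^g`. Some Bohr–Sommerfeld leaf exists for every bundle: on the `a`-lattice the
multiplier at `0` is a unitary character, it lifts to a real functional, and nondegeneracy of `K`
realizes that functional by a suitable `y`.

The topological input is the adapted basis (`exists_isAdaptedBasis`). It rests on the rank of `H¹`
(`finrank_H1`) and on integral Poincaré duality (`exists_intCup_eq`), both obtained directly from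
the cellular complex of the triangulation. -/

noncomputable section

namespace ToralCS

/-! ### Connectedness and the rank of `H¹` -/

namespace Surface

variable {T : Type*} (S : Surface T)

theorem tip_eq_origin_next (s : T × ZMod 3) : S.tip s = S.origin (next s) := rfl

/-- Vertices are connected by edge paths. -/
theorem vertex_induction (P : S.Vertex → Prop) (hP : ∀ s, P (S.origin s) → P (S.tip s))
    {v₀ : S.Vertex} (h₀ : P v₀) (v : S.Vertex) : P v := by
  have hn : ∀ (t : T) (i : ZMod 3), P (S.origin (t, i)) → ∀ j, P (S.origin (t, j)) := by
    intro t i hi j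
    have h : ∀ n : ℕ, P (S.origin (t, i + n)) := by
      intro n
      induction n with
      | zero => simpa using hi
      | succ n ih =>
        have := hP _ ih
        rw [tip_eq_origin_next] at this
        simpa [next, add_assoc] using this
    have := h (j - i).val
    rwa [ZMod.natCast_zmod_val, add_sub_cancel] at this
  obtain ⟨⟨t₀, i₀⟩, rfl⟩ := Quot.exists_rep v₀
  obtain ⟨⟨t, i⟩, rfl⟩ := Quot.exists_rep v
  suffices h : ∀ j, P (S.origin (t, j)) from h i
  induction S.connected t₀ t with
  | refl => exact hn t₀ i₀ h₀
  | @tail u _ _ h ih =>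
    obtain ⟨j, rfl⟩ := h
    refine hn _ (S.glue (u, j)).2 ?_
    change P (S.origin (S.glue (u, j)))
    rw [origin_glue]
    exact hP _ (ih j)

theorem eq_of_origin_eq_tip {X : Type*} (h : S.Vertex → X)
    (hh : ∀ s, h (S.tip s) = h (S.origin s)) (v w : S.Vertex) : h v = h w :=
  S.vertex_induction (fun u => h u = h w) (fun s hs => (hh s).trans hs) rfl v

instance [Finite T] : Finite S.Vertex := inferInstanceAs (Finite (Quot _))

instance [Finite T] : Finite S.Edge := inferInstanceAs (Finite (Quot _))

instance : Nonempty S.Vertex := S.nonempty.map fun t => S.origin (t, 0)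

section Rank

variable (R : Type*) [CommRing R]

/-- Cellular `1`-cochains: functions on sides that change sign under gluing. -/
def cochains : Submodule R (T × ZMod 3 → R) where
  carrier := {f | ∀ s, f (S.glue s) = -f s}
  zero_mem' := by simp
  add_mem' := by
    intro f g hf hg s
    simp only [Pi.add_apply, hf s, hg s]; abel
  smul_mem' := by
    intro c f hf s
    simp [hf s]

/-- The edge underlying a side. -/
def edge (s : T × ZMod 3) : S.Edge := Quot.mk _ s

theorem edge_glue (s : T × ZMod 3) : S.edge (S.glue s) = S.edge s :=
  (Quot.sound rfl : S.edge s = S.edge (S.glue s)).symm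

/-- Gluing is an involution, so the equivalence relation it generates adds nothing beyond the pairs
of glued sides. -/
theorem eq_or_eq_glue_of_edge_eq {s s' : T × ZMod 3} (h : S.edge s = S.edge s') :
    s' = s ∨ s' = S.glue s := by
  have h' := Quot.eqvGen_exact h
  clear h
  induction h' with
  | rel _ _ h => exact Or.inr h
  | refl _ => exact Or.inl rfl
  | symm x y _ ih =>
    rcases ih with rfl | rfl
    · exact Or.inl rfl
    · exact Or.inr (S.glue_glue _).symm
  | trans x y z _ _ ih ih' =>
    rcases ih with rfl | rfl <;> rcases ih' with rfl | rfl <;> simp [S.glue_glue]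

/-- A chosen side representing an edge. -/
def edgeRep (e : S.Edge) : T × ZMod 3 := Quot.out e

theorem edge_edgeRep (e : S.Edge) : S.edge (S.edgeRep e) = e := Quot.out_eq e

open Classical in
/-- Cochains are functions on the set of edges, once each edge is oriented. -/
def cochainsEquiv : S.cochains R ≃ₗ[R] (S.Edge → R) where
  toFun f e := f.1 (S.edgeRep e)
  map_add' _ _ := rfl
  map_smul' _ _ := rfl
  invFun k := ⟨fun s => if S.edgeRep (S.edge s) = s then k (S.edge s) else -k (S.edge s), by
    intro s
    simp only [S.edge_glue]
    rcases S.eq_or_eq_glue_of_edge_eq (S.edge_edgeRep (S.edge s)).symm with h | h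
    · rw [h, if_neg (S.glue_ne s).symm, if_pos rfl]
    · rw [h, if_pos rfl, if_neg (S.glue_ne s), neg_neg]⟩
  left_inv f := by
    ext s
    rcases S.eq_or_eq_glue_of_edge_eq (S.edge_edgeRep (S.edge s)).symm with h | h
    · simp only [h, if_true]
    · simp only [h, S.glue_ne, if_false, f.2 s, neg_neg]
  right_inv k := by
    ext e
    simp only [S.edge_edgeRep, if_true]

/-- The coboundary of a `1`-cochain. -/
def coboundary₁ : S.cochains R →ₗ[R] (T → R) where
  toFun f t := f.1 (t, 0) + f.1 (t, 1) + f.1 (t, 2)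
  map_add' f g := by ext t; simp only [Submodule.coe_add, Pi.add_apply]; abel
  map_smul' c f := by
    ext t; simp only [Submodule.coe_smul, Pi.smul_apply, smul_eq_mul, RingHom.id_apply]; ring

def kerCoboundary₁Equiv : LinearMap.ker (S.coboundary₁ R) ≃ₗ[R] S.cocycles R R where
  toFun f := ⟨f.1.1, f.1.2, fun t => congrFun f.2 t⟩
  invFun f := ⟨⟨f.1, f.2.1⟩, funext f.2.2⟩
  map_add' _ _ := rfl
  map_smul' _ _ := rfl
  left_inv _ := rfl
  right_inv _ := rfl

/-- This is `H⁰ = R`: a closed `0`-cochain does not change along edges, and edge paths join all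
vertices. -/
theorem ker_coboundary : LinearMap.ker (S.coboundary R R) = Submodule.span R {fun _ => 1} := by
  ext h
  rw [LinearMap.mem_ker, Submodule.mem_span_singleton]
  constructor
  · intro hh
    obtain ⟨v₀⟩ : Nonempty S.Vertex := inferInstance
    refine ⟨h v₀, funext fun v => ?_⟩
    simp only [Pi.smul_apply, smul_eq_mul, mul_one]
    exact S.eq_of_origin_eq_tip h (fun s => sub_eq_zero.1 (congrFun (congrArg Subtype.val hh) s)) _ _
  · rintro ⟨c, rfl⟩
    ext s
    simp [coboundary]

variable [Fintype T]

theorem sum_eq_sum_triangles {A : Type*} [AddCommMonoid A] (F : T × ZMod 3 → A) :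
    ∑ s, F s = ∑ t, (F (t, 0) + F (t, 1) + F (t, 2)) := by
  rw [Fintype.sum_prod_type]
  exact Finset.sum_congr rfl fun t _ => Fin.sum_univ_three (fun i : Fin 3 => F (t, i))

theorem sum_glue {A : Type*} [AddCommMonoid A] (F : T × ZMod 3 → A) :
    ∑ s, F (S.glue s) = ∑ s, F s :=
  Equiv.sum_comp (Function.Involutive.toPerm S.glue S.glue_glue) F

theorem sum_eq_zero_of_odd [IsDomain R] [CharZero R] (F : T × ZMod 3 → R)
    (hF : ∀ s, F (S.glue s) = -F s) : ∑ s, F s = 0 := by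
  have h := S.sum_glue F
  simp only [hF, Finset.sum_neg_distrib] at h
  exact neg_eq_self.1 h

/-- The sum of the values of a `2`-cochain. -/
def totalSum : (T → R) →ₗ[R] R := ∑ t, LinearMap.proj t

/-- This is `H² = R`. In the total sum of a coboundary the two sides of each edge cancel. Conversely
the cochain supported on one oriented edge has as coboundary the difference of the two triangles
meeting there, and chains of adjacent triangles give all differences of triangles. -/
theorem range_coboundary₁ [IsDomain R] [CharZero R] :
    LinearMap.range (S.coboundary₁ R) = LinearMap.ker (totalSum (T := T) R) := by
  classical
  apply le_antisymm
  · rintro _ ⟨f, rfl⟩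
    have := S.sum_eq_zero_of_odd R f.1 f.2
    rw [sum_eq_sum_triangles] at this
    simpa [totalSum, coboundary₁] using this
  · have hadj : ∀ t i, Pi.single t 1 - Pi.single (S.glue (t, i)).1 1 ∈
        LinearMap.range (S.coboundary₁ R) := by
      intro t i
      refine ⟨⟨Pi.single (t, i) 1 - Pi.single (S.glue (t, i)) 1, fun s => ?_⟩, ?_⟩
      · have h1 : S.glue s = (t, i) ↔ s = S.glue (t, i) :=
          ⟨fun h => by rw [← h, S.glue_glue], fun h => by rw [h, S.glue_glue]⟩
        have h2 : S.glue s = S.glue (t, i) ↔ s = (t, i) :=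
          ⟨fun h => by rw [← S.glue_glue s, h, S.glue_glue], fun h => by rw [h]⟩
        simp only [Pi.sub_apply, Pi.single_apply, h1, h2]; ring
      · have hs : ∀ s : T × ZMod 3, (fun u : T => (Pi.single s (1 : R) : T × ZMod 3 → R) (u, 0) +
            (Pi.single s (1 : R) : T × ZMod 3 → R) (u, 1) +
            (Pi.single s (1 : R) : T × ZMod 3 → R) (u, 2)) = Pi.single s.1 1 := by
          rintro ⟨u', j⟩
          ext u
          by_cases hu : u = u'
          · subst hu
            have h10 : (1 : ZMod 3) ≠ 0 := by decide
            have h20 : (2 : ZMod 3) ≠ 0 := by decide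
            have h21 : (2 : ZMod 3) ≠ 1 := by decide
            have hj : j = 0 ∨ j = 1 ∨ j = 2 := by revert j; decide
            rcases hj with rfl | rfl | rfl <;>
              simp [Prod.ext_iff, h10, h20, h21, h10.symm, h20.symm, h21.symm]
          · simp [Prod.ext_iff, hu]
        rw [← hs (S.glue (t, i)), ← hs (t, i)]
        ext u
        simp only [coboundary₁, LinearMap.coe_mk, AddHom.coe_mk, Pi.sub_apply]
        ring
    obtain ⟨t₀⟩ := S.nonempty
    have hall : ∀ t, Pi.single t₀ 1 - Pi.single t 1 ∈ LinearMap.range (S.coboundary₁ R) := by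
      intro t
      induction S.connected t₀ t with
      | refl => simp
      | @tail u _ _ h ih =>
        obtain ⟨j, rfl⟩ := h
        have := add_mem ih (hadj u j)
        rwa [sub_add_sub_cancel] at this
    intro ψ hψ
    have hψ' : ∑ t, ψ t = 0 := by simpa [totalSum] using hψ
    -- The multiples of the base triangle `t₀` add up to the total sum of `ψ`, which is zero.
    have e : ψ = -∑ t, ψ t • ((Pi.single t₀ 1 : T → R) - Pi.single t 1) := by
      have e1 : ψ = ∑ t, ψ t • (Pi.single t 1 : T → R) := by
        ext u; simp [Finset.sum_apply, Pi.single_apply]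
      simp only [smul_sub, Finset.sum_sub_distrib, ← Finset.sum_smul, hψ', zero_smul, zero_sub,
        neg_neg]
      exact e1
    rw [e]
    exact neg_mem (sum_mem fun t _ => Submodule.smul_mem _ _ (hall t))

/-- Rank–nullity along the cellular complex, with `H⁰` and `H²` of rank one: the cocycles have rank
`E - (F - 1)` and the coboundaries rank `V - 1`. -/
theorem finrank_H1 [IsDomain R] [CharZero R] [IsNoetherianRing R] :
    (Module.finrank R (S.H1 R R) : ℤ) = 2 - S.eulerChar := by
  classical
  have := Fintype.ofFinite S.Edge
  have := Fintype.ofFinite S.Vertex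
  have h1 := Submodule.finrank_quotient_add_finrank (LinearMap.ker (S.coboundary₁ R))
  rw [(LinearMap.quotKerEquivRange (S.coboundary₁ R)).finrank_eq] at h1
  have h2 := Submodule.finrank_quotient_add_finrank (LinearMap.ker (totalSum (T := T) R))
  rw [(LinearMap.quotKerEquivRange (totalSum (T := T) R)).finrank_eq] at h2
  have h3 := Submodule.finrank_quotient_add_finrank (LinearMap.ker (S.coboundary R R))
  rw [(LinearMap.quotKerEquivRange (S.coboundary R R)).finrank_eq] at h3
  have h4 := Submodule.finrank_quotient_add_finrank (LinearMap.range (S.coboundary R R))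
  rw [range_coboundary₁, (S.kerCoboundary₁Equiv R).finrank_eq, (S.cochainsEquiv R).finrank_eq,
    Module.finrank_fintype_fun_eq_card, ← Nat.card_eq_fintype_card] at h1
  have hsurj : LinearMap.range (totalSum (T := T) R) = ⊤ := by
    rw [LinearMap.range_eq_top]
    intro c
    obtain ⟨t₀⟩ := S.nonempty
    exact ⟨Pi.single t₀ c, by simp [totalSum]⟩
  rw [hsurj, finrank_top, Module.finrank_self, Module.finrank_fintype_fun_eq_card,
    ← Nat.card_eq_fintype_card] at h2
  have hone : (fun _ => 1 : S.Vertex → R) ≠ 0 := fun h => by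
    obtain ⟨v₀⟩ : Nonempty S.Vertex := inferInstance
    exact one_ne_zero (congrFun h v₀)
  rw [ker_coboundary, (LinearEquiv.toSpanNonzeroSingleton R _ _ hone).symm.finrank_eq,
    Module.finrank_self, Module.finrank_fintype_fun_eq_card, ← Nat.card_eq_fintype_card] at h3
  simp only [eulerChar]
  change (Module.finrank R (S.cocycles R R ⧸ _) : ℤ) = _
  omega

theorem finrank_H1_of_hasGenus [IsDomain R] [CharZero R] [IsNoetherianRing R] {g : ℕ}
    (hg : S.HasGenus g) : Module.finrank R (S.H1 R R) = 2 * g := by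
  have := S.finrank_H1 R
  rw [hg] at this
  omega

end Rank

end Surface

/-! ### Two integral tools for Poincaré duality -/

/-- A linear functional on a saturated submodule of a finite `ℤ`-module extends. -/
theorem exists_extend_of_saturated {M : Type*} [AddCommGroup M] [Module.Finite ℤ M]
    (N : Submodule ℤ M) (hN : ∀ (n : ℤ) (x : M), n • x ∈ N → n = 0 ∨ x ∈ N) (φ : N →ₗ[ℤ] ℤ) :
    ∃ ψ : M →ₗ[ℤ] ℤ, ∀ x : N, ψ x = φ x := by
  -- Saturation makes the quotient torsion-free, hence free, so `N` is a direct summand; `π` below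
  -- is the resulting retraction onto it.
  have : Module.IsTorsionFree ℤ (M ⧸ N) := by
    refine .of_smul_eq_zero fun n y hy => ?_
    obtain ⟨x, rfl⟩ := N.mkQ_surjective y
    rw [← map_smul, Submodule.mkQ_apply, Submodule.Quotient.mk_eq_zero] at hy
    rw [Submodule.mkQ_apply, Submodule.Quotient.mk_eq_zero]
    exact hN n x hy
  have : Module.Free ℤ (M ⧸ N) := Module.free_of_finite_type_torsion_free'
  obtain ⟨s, hs⟩ := Module.projective_lifting_property N.mkQ LinearMap.id N.mkQ_surjective
  have hs' : ∀ y, N.mkQ (s y) = y := fun y => LinearMap.congr_fun hs y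
  let π : M →ₗ[ℤ] N := (LinearMap.id - s ∘ₗ N.mkQ).codRestrict N fun x => by
    rw [← Submodule.Quotient.mk_eq_zero, ← Submodule.mkQ_apply, LinearMap.sub_apply, map_sub,
      LinearMap.comp_apply, hs', LinearMap.id_apply, sub_self]
  refine ⟨φ ∘ₗ π, fun x => congrArg φ (Subtype.ext ?_)⟩
  have hx : N.mkQ (x : M) = 0 := by simp
  change (x : M) - s (N.mkQ x) = x
  rw [hx, map_zero, sub_zero]

/-- A function on a finite set is a difference `p ∘ σ - p` as soon as it is orthogonal to the
`σ`-invariant functions. -/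
theorem exists_potential {X : Type*} [Fintype X] (σ : Equiv.Perm X) (γ : X → ℤ)
    (hγ : ∀ h : X → ℤ, (∀ x, h (σ x) = h x) → ∑ x, γ x * h x = 0) :
    ∃ p : X → ℤ, ∀ x, p (σ x) = p x + γ x := by
  classical
  have hcyc : ∀ (k : ℕ) (y : X), (σ ^ k) y = y → ∑ i ∈ Finset.range k, γ ((σ ^ i) y) = 0 := by
    intro k y hk
    -- The test function counts visits of the closed orbit of `y`. It is invariant because shifting
    -- the index by one only exchanges the endpoints `i = 0` and `i = k`, which agree.
    have h := hγ (fun x => ∑ i ∈ Finset.range k, if (σ ^ i) y = x then 1 else 0) (fun x => by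
      have e : ∀ i, (if (σ ^ i) y = x then (1 : ℤ) else 0) =
          if (σ ^ (i + 1)) y = σ x then 1 else 0 := fun i => by
        simp [pow_succ', Equiv.Perm.mul_apply]
      simp only [e]
      have h1 := Finset.sum_range_succ (fun i => if (σ ^ i) y = σ x then (1 : ℤ) else 0) k
      have h2 := Finset.sum_range_succ' (fun i => if (σ ^ i) y = σ x then (1 : ℤ) else 0) k
      simp only [hk, pow_zero, Equiv.Perm.one_apply] at h1 h2
      linarith)
    simp only [Finset.mul_sum] at h
    rw [Finset.sum_comm] at h
    simpa using h
  have hle : ∀ (m n : ℕ) (r : X), m ≤ n → (σ ^ m) r = (σ ^ n) r →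
      ∑ i ∈ Finset.range m, γ ((σ ^ i) r) = ∑ i ∈ Finset.range n, γ ((σ ^ i) r) := by
    intro m n r hmn h
    obtain ⟨k, rfl⟩ := Nat.exists_eq_add_of_le hmn
    have := hcyc k ((σ ^ m) r) (by
      rw [← Equiv.Perm.mul_apply, ← pow_add, add_comm, h])
    rw [Finset.sum_range_add]
    simp only [← Equiv.Perm.mul_apply, ← pow_add] at this
    simp only [add_comm m, this, add_zero]
  have heq : ∀ (m n : ℕ) (r : X), (σ ^ m) r = (σ ^ n) r →
      ∑ i ∈ Finset.range m, γ ((σ ^ i) r) = ∑ i ∈ Finset.range n, γ ((σ ^ i) r) := by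
    intro m n r h
    rcases le_total m n with hmn | hmn
    · exact hle m n r hmn h
    · exact (hle n m r hmn h.symm).symm
  let r : X → X := fun x => (Quotient.mk (Equiv.Perm.SameCycle.setoid σ) x).out
  have hr : ∀ x, σ.SameCycle (r x) x := fun x =>
    Quotient.exact (s := Equiv.Perm.SameCycle.setoid σ) (Quotient.out_eq _)
  have hrσ : ∀ x, r (σ x) = r x := fun x => by
    simp only [r]
    congr 1
    exact Quotient.sound (s := Equiv.Perm.SameCycle.setoid σ)
      (Equiv.Perm.sameCycle_apply_left.2 (Equiv.Perm.SameCycle.refl σ x))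
  have hn : ∀ x, ∃ n : ℕ, (σ ^ n) (r x) = x := fun x => by
    obtain ⟨n, -, hn⟩ := (hr x).exists_pow_eq'
    exact ⟨n, hn⟩
  choose n hn using hn
  -- The potential accumulates `γ` from the chosen representative of the cycle up to `x`; vanishing
  -- of the sums over closed orbits makes the number of steps irrelevant.
  refine ⟨fun x => ∑ i ∈ Finset.range (n x), γ ((σ ^ i) (r x)), fun x => ?_⟩
  have h1 := heq (n (σ x)) (n x + 1) (r x) (by
    have := hn (σ x)
    rw [hrσ] at this
    rw [this, pow_succ', Equiv.Perm.mul_apply, hn])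
  rw [Finset.sum_range_succ, hn] at h1
  simp only [hrσ]
  exact h1

/-! ### The integral lattice and Poincaré duality -/

namespace Surface

variable {T : Type*} (S : Surface T)

theorem integral_cls (f : S.cocycles ℤ ℤ) : S.integral (S.cls ℤ ℤ f) =
    S.cls ℝ ℝ (S.mapCocycles (Int.castRingHom ℝ).toSemilinearMap f) := rfl

/-- A real primitive of an integral cocycle has integral increments along edges. By connectedness,
subtracting its value at one vertex makes it integral. -/
theorem integral_injective : Function.Injective S.integral := by
  rw [injective_iff_map_eq_zero]
  intro c hc
  obtain ⟨f, rfl⟩ := Submodule.mkQ_surjective _ c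
  change S.integral (S.cls ℤ ℤ f) = 0 at hc
  rw [integral_cls, Submodule.mkQ_apply, Submodule.Quotient.mk_eq_zero] at hc
  obtain ⟨h, hh⟩ := hc
  have hh' : ∀ s, h (S.tip s) - h (S.origin s) = f.1 s := fun s =>
    congrFun (congrArg Subtype.val hh) s
  obtain ⟨v₀⟩ : Nonempty S.Vertex := inferInstance
  have hint : ∀ v, ∃ n : ℤ, h v - h v₀ = n :=
    S.vertex_induction (fun v => ∃ n : ℤ, h v - h v₀ = n) (v₀ := v₀) (fun s ⟨n, hn⟩ =>
      ⟨n + f.1 s, by push_cast; rw [← hn, ← hh' s]; ring⟩) ⟨0, by simp⟩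
  choose k hk using hint
  rw [Submodule.mkQ_apply, Submodule.Quotient.mk_eq_zero]
  refine ⟨k, Subtype.ext (funext fun s => ?_)⟩
  have : ((k (S.tip s) - k (S.origin s) : ℤ) : ℝ) = f.1 s := by
    push_cast; rw [← hk, ← hk, ← hh' s]; ring
  exact_mod_cast this

instance : Module.IsTorsionFree ℤ (S.H1 ℤ ℤ) := by
  refine .of_smul_eq_zero fun n y hy => ?_
  have : (n : ℝ) • S.integral y = 0 := by
    have := congrArg S.integral hy
    rwa [map_smulₛₗ, map_zero] at this
  rcases smul_eq_zero.1 this with h | h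
  · exact Or.inl (by exact_mod_cast h)
  · exact Or.inr (S.integral_injective (by rw [h, map_zero]))

variable [Fintype T]

instance : Module.Free ℤ (S.H1 ℤ ℤ) := Module.free_of_finite_type_torsion_free'

theorem cup_integral_cls (f f' : S.cocycles ℤ ℤ) :
    S.cup (S.integral (S.cls ℤ ℤ f)) (S.integral (S.cls ℤ ℤ f')) =
      ((∑ t, (f.1 (t, 0) * f'.1 (t, 1) - f.1 (t, 1) * f'.1 (t, 0)) : ℤ) : ℝ) / 2 := by
  change S.pairingCocycles (LinearMap.mul ℝ ℝ) (S.mapCocycles _ f) (S.mapCocycles _ f') = _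
  rw [pairingCocycles_apply, Int.cast_sum, Finset.sum_div]
  refine Finset.sum_congr rfl fun t _ => ?_
  simp [mapCocycles]

theorem exists_int_cup (c d : S.H1 ℤ ℤ) :
    ∃ n : ℤ, S.cup (S.integral c) (S.integral d) = n := by
  obtain ⟨n, hn⟩ := S.exists_int_pairing (LinearMap.mul ℤ ℤ) c d
  refine ⟨n, ?_⟩
  rw [← hn]
  obtain ⟨f, rfl⟩ := Submodule.mkQ_surjective _ c
  obtain ⟨f', rfl⟩ := Submodule.mkQ_surjective _ d
  change S.cup (S.integral (S.cls ℤ ℤ f)) (S.integral (S.cls ℤ ℤ f')) =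
    S.pairingCocycles (realForm (LinearMap.mul ℤ ℤ)) (S.mapCocycles (incl ℤ) f)
      (S.mapCocycles (incl ℤ) f')
  rw [cup_integral_cls, pairingCocycles_apply, Int.cast_sum, Finset.sum_div]
  refine Finset.sum_congr rfl fun t _ => ?_
  simp [mapCocycles, realForm_incl]

theorem cup_flip (c d : S.H1 ℝ ℝ) : S.cup c d = -S.cup d c := by
  have : (LinearMap.mul ℝ ℝ).flip = LinearMap.mul ℝ ℝ := by
    ext; simp
  rw [cup, pairing_flip]
  change -S.pairing (LinearMap.mul ℝ ℝ).flip d c = _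
  rw [this]

/-- The cup product of two integral classes, as an integer. -/
def intCupAux (c d : S.H1 ℤ ℤ) : ℤ := (S.exists_int_cup c d).choose

theorem cast_intCupAux (c d : S.H1 ℤ ℤ) :
    (S.intCupAux c d : ℝ) = S.cup (S.integral c) (S.integral d) :=
  (S.exists_int_cup c d).choose_spec.symm

/-- The intersection form on `H¹(S; ℤ)`. -/
def intCup : LinearMap.BilinForm ℤ (S.H1 ℤ ℤ) :=
  LinearMap.mk₂ ℤ S.intCupAux
    (fun c c' d => Int.cast_injective (α := ℝ) (by
      simp only [Int.cast_add, cast_intCupAux, map_add, LinearMap.add_apply]))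
    (fun n c d => Int.cast_injective (α := ℝ) (by
      simp only [smul_eq_mul, Int.cast_mul, cast_intCupAux, map_smulₛₗ, LinearMap.smul_apply,
        eq_intCast, RingHom.id_apply]))
    (fun c d d' => Int.cast_injective (α := ℝ) (by
      simp only [Int.cast_add, cast_intCupAux, map_add]))
    (fun n c d => Int.cast_injective (α := ℝ) (by
      simp only [smul_eq_mul, Int.cast_mul, cast_intCupAux, map_smulₛₗ, eq_intCast,
        RingHom.id_apply]))

theorem cast_intCup (c d : S.H1 ℤ ℤ) :
    (S.intCup c d : ℝ) = S.cup (S.integral c) (S.integral d) := S.cast_intCupAux c d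

theorem intCup_flip (c d : S.H1 ℤ ℤ) : S.intCup c d = -S.intCup d c := by
  have : (S.intCup c d : ℝ) = -S.intCup d c := by
    rw [cast_intCup, cast_intCup, cup_flip]
  exact_mod_cast this

theorem two_mul_intCup (f f' : S.cocycles ℤ ℤ) : 2 * S.intCup (S.cls ℤ ℤ f) (S.cls ℤ ℤ f') =
    ∑ t, (f.1 (t, 0) * f'.1 (t, 1) - f.1 (t, 1) * f'.1 (t, 0)) := by
  have h := S.cast_intCup (S.cls ℤ ℤ f) (S.cls ℤ ℤ f')
  rw [cup_integral_cls, eq_div_iff two_ne_zero] at h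
  rw [mul_comm]
  exact_mod_cast h

/-- Rotation about the initial vertex of a side. -/
def rotate : Equiv.Perm (T × ZMod 3) where
  toFun s := next (S.glue s)
  invFun s := S.glue (s.1, s.2 - 1)
  left_inv s := by simp [next, S.glue_glue]
  right_inv s := by simp [next, S.glue_glue]

/-- Poincaré duality: every integral functional on `H¹(S; ℤ)` is a cup product. -/
theorem exists_intCup_eq (φ : S.H1 ℤ ℤ →ₗ[ℤ] ℤ) : ∃ c, ∀ d, S.intCup c d = φ d := by
  classical
  -- The functional is extended from cocycles to all functions on sides, where it has coefficients
  -- `c`. On odd functions only the antisymmetrization `γ` of `c` matters.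
  obtain ⟨ψ, hψ⟩ := exists_extend_of_saturated (S.cocycles ℤ ℤ) (by
    intro n f hf
    rw [or_iff_not_imp_left]
    intro hn
    refine ⟨fun s => ?_, fun t => ?_⟩
    · have := hf.1 s
      simp only [Pi.smul_apply, smul_eq_mul, ← mul_neg] at this
      exact mul_left_cancel₀ hn this
    · have := hf.2 t
      simp only [Pi.smul_apply, smul_eq_mul, ← mul_add] at this
      exact (mul_eq_zero.1 this).resolve_left hn) (φ ∘ₗ S.cls ℤ ℤ)
  let c : T × ZMod 3 → ℤ := fun s => ψ (Pi.single s 1)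
  have hc : ∀ f, ψ f = ∑ s, c s * f s := fun f => by
    conv_lhs => rw [pi_eq_sum_univ' f]
    rw [map_sum]
    refine Finset.sum_congr rfl fun s _ => ?_
    rw [map_smul, smul_eq_mul, mul_comm]
  let γ : T × ZMod 3 → ℤ := fun s => c (S.glue s) - c s
  have hγ : ∀ s, γ (S.glue s) = -γ s := fun s => by simp [γ, S.glue_glue]
  have hγψ : ∀ f : T × ZMod 3 → ℤ, (∀ s, f (S.glue s) = -f s) → ∑ s, γ s * f s = -2 * ψ f := by
    intro f hf
    have e := S.sum_glue (fun s => c s * f s)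
    simp only [hf, mul_neg, Finset.sum_neg_distrib] at e
    simp only [γ, sub_mul, Finset.sum_sub_distrib]
    rw [hc]
    linarith
  -- Functions invariant under rotation are functions of the vertices. They are orthogonal to `γ`
  -- because `φ` kills coboundaries.
  obtain ⟨p, hp⟩ := exists_potential S.rotate γ (fun h hh => by
    let k : S.Vertex → ℤ := Quot.lift h (by rintro s _ rfl; exact (hh s).symm)
    have h1 := hγψ (S.coboundary ℤ ℤ k).1 (S.coboundary ℤ ℤ k).2.1
    have h0 : S.cls ℤ ℤ (S.coboundary ℤ ℤ k) = 0 :=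
      (Submodule.Quotient.mk_eq_zero _).2 (LinearMap.mem_range_self _ k)
    have h2 : ψ (S.coboundary ℤ ℤ k).1 = 0 := by
      rw [hψ, LinearMap.comp_apply, h0, map_zero]
    have h3 : ∀ s, (S.coboundary ℤ ℤ k).1 s = h (S.glue s) - h s := fun s => by
      change k (S.tip s) - k (S.origin s) = _
      rw [← S.origin_glue]; rfl
    have h4 := S.sum_glue (fun s => γ s * h s)
    simp only [h3, h2, mul_zero, mul_sub, Finset.sum_sub_distrib] at h1
    simp only [hγ, neg_mul, Finset.sum_neg_distrib] at h4
    linarith)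
  change ∀ s, p (next (S.glue s)) = p s + γ s at hp
  have hp' : ∀ s, p (next s) = p (S.glue s) - γ s := fun s => by
    have := hp (S.glue s)
    rw [S.glue_glue, hγ] at this
    rw [this]; ring
  -- With `p` read as a value at each corner, differences within a triangle sum to zero
  -- automatically; oddness across an edge is the equation satisfied by `p`.
  let a : S.cocycles ℤ ℤ := ⟨fun s => p (next s) - p s, fun s => by
    simp only [hp, hp']; ring, fun t => by
    have h0 : next (t, (0 : ZMod 3)) = (t, 1) := by simp [next]
    have h1 : next (t, (1 : ZMod 3)) = (t, 2) := by simp only [next]; rfl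
    have h2 : next (t, (2 : ZMod 3)) = (t, 0) := by simp only [next]; rfl
    simp only [h0, h1, h2]; ring⟩
  refine ⟨S.cls ℤ ℤ a, fun d => ?_⟩
  obtain ⟨f, rfl⟩ := Submodule.mkQ_surjective _ d
  have h1 := S.two_mul_intCup a f
  have h2 : ∑ t, (a.1 (t, 0) * f.1 (t, 1) - a.1 (t, 1) * f.1 (t, 0)) =
      ∑ s, (p s + p (next s)) * f.1 s := by
    rw [sum_eq_sum_triangles]
    refine Finset.sum_congr rfl fun t _ => ?_
    have h0 : next (t, (0 : ZMod 3)) = (t, 1) := by simp [next]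
    have h1 : next (t, (1 : ZMod 3)) = (t, 2) := by simp only [next]; rfl
    have h2 : next (t, (2 : ZMod 3)) = (t, 0) := by simp only [next]; rfl
    have h3 : f.1 (t, 2) = -(f.1 (t, 0) + f.1 (t, 1)) := eq_neg_of_add_eq_zero_right (f.2.2 t)
    simp only [a, h0, h1, h2, h3]; ring
  have h3 := S.sum_glue (fun s => p s * f.1 s)
  have h4 := hγψ f.1 f.2.1
  rw [hψ, LinearMap.comp_apply] at h4
  simp only [f.2.1, mul_neg, Finset.sum_neg_distrib] at h3
  -- The first two sums on the right cancel since `f` is odd, and the `γ` sum equals `-2 φ`; both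
  -- sides of the duality are thus compared after doubling.
  have h5 : ∑ s, (p s + p (next s)) * f.1 s =
      ∑ s, p s * f.1 s + ∑ s, p (S.glue s) * f.1 s - ∑ s, γ s * f.1 s := by
    rw [← Finset.sum_add_distrib, ← Finset.sum_sub_distrib]
    refine Finset.sum_congr rfl fun s _ => ?_
    rw [hp']; ring
  change S.intCup (S.cls ℤ ℤ a) (S.cls ℤ ℤ f) = φ (S.cls ℤ ℤ f)
  linarith

end Surface

/-! ### Symplectic bases adapted to a Lagrangian -/

theorem linearIndependent_of_symplectic {R V ι : Type*} [CommRing R] [AddCommGroup V] [Module R V]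
    [Fintype ι] [DecidableEq ι] (B : LinearMap.BilinForm R V) (a b : ι → V)
    (haa : ∀ i j, B (a i) (a j) = 0) (hbb : ∀ i j, B (b i) (b j) = 0)
    (hab : ∀ i j, B (a i) (b j) = if i = j then 1 else 0) :
    LinearIndependent R (Sum.elim a b) := by
  rw [Fintype.linearIndependent_iff]
  intro c hc
  rw [Fintype.sum_sum_type] at hc
  simp only [Sum.elim_inl, Sum.elim_inr] at hc
  have hr : ∀ i, c (Sum.inr i) = 0 := fun i => by
    have := congrArg (B (a i)) hc
    simpa [map_sum, haa, hab] using this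
  rintro (i | i)
  · have := congrArg (fun v => B v (b i)) hc
    simpa [map_sum, LinearMap.sum_apply, hbb, hab] using this
  · exact hr i

namespace Surface

variable {T : Type*} (S : Surface T) [Fintype T]

/-- The integral classes in `L` form a saturated isotropic lattice `M` with a basis `a`. Coordinate
functionals of `M` extend to all of `H¹(S; ℤ)`, so Poincaré duality gives classes dual to `a`, which
are then corrected by elements of `M` to become isotropic. Maximality of `L` yields integral
spanning, and rationality yields that `a` spans `L`. -/
theorem exists_isAdaptedBasis {g : ℕ} (hg : S.HasGenus g) (L : Submodule ℝ (S.H1 ℝ ℝ))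
    (hrat : S.IsRational L) (hlag : S.IsLagrangian L) :
    ∃ a b : Fin g → S.H1 ℤ ℤ, S.IsAdaptedBasis L a b := by
  let M : Submodule ℤ (S.H1 ℤ ℤ) :=
    { carrier := {x | S.integral x ∈ L}
      zero_mem' := by simp
      add_mem' := fun {x y} hx hy => by
        change S.integral (x + y) ∈ L
        rw [map_add]; exact add_mem hx hy
      smul_mem' := fun n x hx => by
        change S.integral (n • x) ∈ L
        rw [map_smulₛₗ]; exact L.smul_mem _ hx }
  have hM : ∀ x, x ∈ M ↔ S.integral x ∈ L := fun _ => Iff.rfl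
  have hsat : ∀ (n : ℤ) (x : S.H1 ℤ ℤ), n • x ∈ M → n = 0 ∨ x ∈ M := by
    intro n x hx
    rw [or_iff_not_imp_left]
    intro hn
    rw [hM, map_smulₛₗ] at hx
    exact (L.smul_mem_iff (by simpa using hn)).1 hx
  obtain ⟨m, ⟨e⟩⟩ : ∃ m, Nonempty (Module.Basis (Fin m) ℤ M) := ⟨_, ⟨Module.finBasis ℤ M⟩⟩
  let a : Fin m → S.H1 ℤ ℤ := fun i => e i
  have hexp : ∀ x (hx : x ∈ M), x = ∑ i, e.repr ⟨x, hx⟩ i • a i := fun x hx => by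
    have := congrArg M.subtype (e.sum_repr ⟨x, hx⟩)
    rw [map_sum] at this
    exact this.symm
  have haL : ∀ i, S.integral (a i) ∈ L := fun i => (e i).2
  have hdual : ∀ j, ∃ b, ∀ i, S.intCup (a i) b = if i = j then 1 else 0 := by
    intro j
    obtain ⟨ψ, hψ⟩ := exists_extend_of_saturated M hsat (e.coord j)
    obtain ⟨c, hc⟩ := S.exists_intCup_eq ψ
    refine ⟨-c, fun i => ?_⟩
    rw [map_neg, ← intCup_flip, hc, hψ, Module.Basis.coord_apply, Module.Basis.repr_self,
      Finsupp.single_apply]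
  choose b₀ hb₀ using hdual
  have haa : ∀ i j, S.intCup (a i) (a j) = 0 := fun i j => by
    have := S.cast_intCup (a i) (a j)
    rw [(hlag _).1 (haL i) _ (haL j)] at this
    exact_mod_cast this
  have hb₀' : ∀ i j, S.intCup (b₀ j) (a i) = -if i = j then 1 else 0 := fun i j => by
    rw [intCup_flip, hb₀]
  -- For each pair of indices the whole correction is charged to the larger one, which avoids
  -- dividing by two.
  let q : Fin m → Fin m → ℤ := fun i j => if j < i then S.intCup (b₀ j) (b₀ i) else 0
  let b : Fin m → S.H1 ℤ ℤ := fun j => b₀ j + ∑ k, q j k • a k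
  have hab : ∀ i j, S.intCup (a i) (b j) = if i = j then 1 else 0 := fun i j => by
    simp [b, map_sum, haa, hb₀]
  have hbb : ∀ i j, S.intCup (b i) (b j) = 0 := fun i j => by
    have h1 : S.intCup (b i) (b j) = S.intCup (b₀ i) (b₀ j) - q j i + q i j := by
      have h2 : S.intCup (b i) (b j) = S.intCup (b₀ i) (b j) + ∑ k, q i k * S.intCup (a k) (b j) := by
        simp [b, map_sum, LinearMap.sum_apply]
      rw [h2]
      simp only [hab]
      simp [b, map_sum, hb₀', sub_eq_add_neg]
    rw [h1]
    simp only [q]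
    rcases lt_trichotomy i j with h | rfl | h
    · simp [h, h.not_gt]
    · have := S.intCup_flip (b₀ i) (b₀ i)
      simp; linarith
    · simp only [h, h.not_gt, if_true, if_false]
      rw [S.intCup_flip (b₀ j) (b₀ i)]; ring
  have hLa : L = Submodule.span ℝ (Set.range fun i => S.integral (a i)) := by
    apply le_antisymm
    · rw [hrat, Submodule.span_le]
      rintro _ ⟨hx, x, rfl⟩
      rw [hexp x hx, map_sum]
      refine sum_mem fun i _ => ?_
      rw [map_smulₛₗ]
      exact Submodule.smul_mem _ _ (Submodule.subset_span ⟨i, rfl⟩)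
    · rw [Submodule.span_le]
      rintro _ ⟨i, rfl⟩
      exact haL i
  have hspan : Submodule.span ℤ (Set.range (Sum.elim a b)) = ⊤ := by
    rw [eq_top_iff]
    rintro x -
    have ha : ∀ i, a i ∈ Submodule.span ℤ (Set.range (Sum.elim a b)) := fun i =>
      Submodule.subset_span ⟨Sum.inl i, rfl⟩
    have hb : ∀ i, b i ∈ Submodule.span ℤ (Set.range (Sum.elim a b)) := fun i =>
      Submodule.subset_span ⟨Sum.inr i, rfl⟩
    -- Removing the `b`-components makes `y` orthogonal to every `a i`, hence to `L`, and the
    -- Lagrangian condition puts it in `M`.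
    let y := x - ∑ i, S.intCup (a i) x • b i
    have hya : ∀ i, S.intCup y (a i) = 0 := fun i => by
      rw [intCup_flip]
      simp [y, map_sum, hab]
    have hy : y ∈ M := by
      rw [hM, hlag, hLa]
      intro d hd
      induction hd using Submodule.span_induction with
      | mem d hd =>
        obtain ⟨i, rfl⟩ := hd
        rw [← cast_intCup, hya, Int.cast_zero]
      | zero => simp
      | add d d' _ _ h h' => rw [map_add, h, h', add_zero]
      | smul r d _ h => rw [map_smul, h, smul_zero]
    have hy' : y ∈ Submodule.span ℤ (Set.range (Sum.elim a b)) := by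
      rw [hexp y hy]
      exact sum_mem fun i _ => Submodule.smul_mem _ _ (ha i)
    have hx : x = y + ∑ i, S.intCup (a i) x • b i := by simp [y]
    rw [hx]
    exact add_mem hy' (sum_mem fun i _ => Submodule.smul_mem _ _ (hb i))
  have hli := linearIndependent_of_symplectic S.intCup a b haa hbb hab
  -- The size of the basis of `M` is identified only now, by comparing `2m` with the rank of `H¹`.
  have hm : m = g := by
    have h1 := Module.finrank_eq_card_basis (Module.Basis.mk hli hspan.ge)
    rw [S.finrank_H1_of_hasGenus ℤ hg, Fintype.card_sum, Fintype.card_fin] at h1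
    omega
  have key : S.IsAdaptedBasis L a b :=
    { linearIndependent := hli
      span_eq_top := hspan
      cup_a_a := fun i j => by rw [← cast_intCup, haa, Int.cast_zero]
      cup_b_b := fun i j => by rw [← cast_intCup, hbb, Int.cast_zero]
      cup_a_b := fun i j => by rw [← cast_intCup, hab]; split_ifs <;> simp
      span_a := hLa }
  subst hm
  exact ⟨a, b, key⟩

namespace IsAdaptedBasis

variable {S} {L : Submodule ℝ (S.H1 ℝ ℝ)} {g : ℕ} {a b : Fin g → S.H1 ℤ ℤ}

theorem cup_b_a (h : S.IsAdaptedBasis L a b) (i j : Fin g) :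
    S.cup (S.integral (b i)) (S.integral (a j)) = -if i = j then 1 else 0 := by
  rw [cup_flip, h.cup_a_b]
  simp [eq_comm]

theorem exists_int_coords (h : S.IsAdaptedBasis L a b) (c : S.H1 ℤ ℤ) :
    ∃ x y : Fin g → ℤ, c = ∑ j, x j • a j + ∑ j, y j • b j := by
  have hc : c ∈ Submodule.span ℤ (Set.range (Sum.elim a b)) := by
    rw [h.span_eq_top]; trivial
  obtain ⟨r, rfl⟩ := (Submodule.mem_span_range_iff_exists_fun ℤ).1 hc
  exact ⟨fun j => r (Sum.inl j), fun j => r (Sum.inr j), by simp [Fintype.sum_sum_type]⟩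

/-- The symplectic relations make the `2g` real classes independent, and the dimension is `2g`; this
is where the genus enters over `ℝ`. -/
theorem exists_real_coords (h : S.IsAdaptedBasis L a b) (hg : S.HasGenus g) (c : S.H1 ℝ ℝ) :
    ∃ x y : Fin g → ℝ, c = ∑ j, x j • S.integral (a j) + ∑ j, y j • S.integral (b j) := by
  have hli := linearIndependent_of_symplectic S.cup (fun i => S.integral (a i))
    (fun i => S.integral (b i)) h.cup_a_a h.cup_b_b h.cup_a_b
  have hc := hli.span_eq_top_of_card_eq_finrank' (by
    rw [S.finrank_H1_of_hasGenus ℝ hg, Fintype.card_sum, Fintype.card_fin, two_mul])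
  have hc' : c ∈ Submodule.span ℝ (Set.range (Sum.elim (fun i => S.integral (a i))
    (fun i => S.integral (b i)))) := by rw [hc]; trivial
  obtain ⟨r, rfl⟩ := (Submodule.mem_span_range_iff_exists_fun ℝ).1 hc'
  exact ⟨fun j => r (Sum.inl j), fun j => r (Sum.inr j), by simp [Fintype.sum_sum_type]⟩

end IsAdaptedBasis

end Surface

/-! ### Classes with coefficients in `Λ` and `𝔱` -/

namespace Surface

variable {T : Type*} (S : Surface T)

section Combine

variable {R A : Type*} [CommRing R] [AddCommGroup A] [Module R A]

theorem mapH1_cls {R R' : Type*} [CommRing R] [CommRing R'] {σ : R →+* R'}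
    {A B : Type*} [AddCommGroup A] [Module R A] [AddCommGroup B] [Module R' B] (f : A →ₛₗ[σ] B)
    (c : S.cocycles R A) : S.mapH1 f (S.cls R A c) = S.cls R' B (S.mapCocycles f c) := rfl

theorem mapCocycles_apply {R R' : Type*} [CommRing R] [CommRing R'] {σ : R →+* R'}
    {A B : Type*} [AddCommGroup A] [Module R A] [AddCommGroup B] [Module R' B] (f : A →ₛₗ[σ] B)
    (c : S.cocycles R A) (s : T × ZMod 3) : (S.mapCocycles f c).1 s = f (c.1 s) := rfl

variable (R A) in
/-- The product `H¹(S; R) × A → H¹(S; A)`. -/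
def tmul : S.H1 R R →ₗ[R] A →ₗ[R] S.H1 R A :=
  LinearMap.mk₂ R (fun c x => S.mapH1 (LinearMap.toSpanSingleton R A x) c)
    (fun _ _ _ => map_add _ _ _) (fun r c x => map_smul _ r c)
    (fun c x y => by
      obtain ⟨c, rfl⟩ := Submodule.mkQ_surjective _ c
      change S.cls R A (S.mapCocycles (LinearMap.toSpanSingleton R A (x + y)) c) =
        S.cls R A (S.mapCocycles (LinearMap.toSpanSingleton R A x) c +
          S.mapCocycles (LinearMap.toSpanSingleton R A y) c)
      congr 1
      ext s
      simp [mapCocycles_apply])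
    (fun r c x => by
      obtain ⟨c, rfl⟩ := Submodule.mkQ_surjective _ c
      change S.cls R A (S.mapCocycles (LinearMap.toSpanSingleton R A (r • x)) c) =
        S.cls R A (r • S.mapCocycles (LinearMap.toSpanSingleton R A x) c)
      congr 1
      ext s
      simp only [mapCocycles_apply, LinearMap.toSpanSingleton_apply, Submodule.coe_smul,
        Pi.smul_apply]
      rw [smul_comm])

theorem tmul_cls (c : S.cocycles R R) (x : A) : S.tmul R A (S.cls R R c) x =
    S.cls R A (S.mapCocycles (LinearMap.toSpanSingleton R A x) c) := rfl

/-- Every class is a sum of products with the vectors of a basis of the coefficients. -/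
theorem eq_sum_tmul {ι : Type*} [Fintype ι] (e : Module.Basis ι R A) (v : S.H1 R A) :
    v = ∑ i, S.tmul R A (S.mapH1 (e.coord i) v) (e i) := by
  obtain ⟨f, rfl⟩ := Submodule.mkQ_surjective _ v
  change S.cls R A f = ∑ i, S.tmul R A (S.mapH1 (e.coord i) (S.cls R A f)) (e i)
  simp only [mapH1_cls, tmul_cls, ← map_sum]
  congr 1
  ext s
  rw [AddSubmonoidClass.coe_finsetSum, Finset.sum_apply]
  simp only [mapCocycles_apply, LinearMap.toSpanSingleton_apply, Module.Basis.coord_apply]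
  exact (e.sum_repr _).symm

variable {ι : Type*} [Fintype ι]

variable (A) in
/-- The map `(xⱼ) ↦ ∑ⱼ cⱼ ⊗ xⱼ`. -/
def combine (c : ι → S.H1 R R) : (ι → A) →ₗ[R] S.H1 R A :=
  ∑ j, S.tmul R A (c j) ∘ₗ LinearMap.proj j

theorem combine_apply (c : ι → S.H1 R R) (x : ι → A) :
    S.combine A c x = ∑ j, S.tmul R A (c j) (x j) := by
  simp [combine, LinearMap.sum_apply]

theorem tmul_mem_range_combine (c : ι → S.H1 R R) {d : S.H1 R R}
    (hd : d ∈ Submodule.span R (Set.range c)) (x : A) :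
    S.tmul R A d x ∈ LinearMap.range (S.combine A c) := by
  obtain ⟨r, rfl⟩ := (Submodule.mem_span_range_iff_exists_fun R).1 hd
  refine ⟨fun j => r j • x, ?_⟩
  simp [combine_apply, map_sum, LinearMap.sum_apply]

/-- Coordinates for scalar classes suffice, since a basis of `A` splits any class into products. The
general ring serves both the lattice and its real span. -/
theorem exists_eq_combine_add_combine {κ : Type*} [Fintype κ] (e : Module.Basis κ R A)
    (a b : ι → S.H1 R R) (h : ∀ c, ∃ x y : ι → R, c = ∑ j, x j • a j + ∑ j, y j • b j)
    (v : S.H1 R A) : ∃ x y : ι → A, v = S.combine A a x + S.combine A b y := by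
  suffices hv : v ∈ LinearMap.range (S.combine A a) ⊔ LinearMap.range (S.combine A b) by
    obtain ⟨_, ⟨x, rfl⟩, _, ⟨y, rfl⟩, h⟩ := Submodule.mem_sup.1 hv
    exact ⟨x, y, h.symm⟩
  rw [S.eq_sum_tmul e v]
  refine sum_mem fun i _ => ?_
  obtain ⟨x, y, hxy⟩ := h (S.mapH1 (e.coord i) v)
  rw [hxy, map_add, LinearMap.add_apply]
  exact add_mem
    (Submodule.mem_sup_left (S.tmul_mem_range_combine _ (sum_mem fun j _ =>
      Submodule.smul_mem _ _ (Submodule.subset_span ⟨j, rfl⟩)) _))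
    (Submodule.mem_sup_right (S.tmul_mem_range_combine _ (sum_mem fun j _ =>
      Submodule.smul_mem _ _ (Submodule.subset_span ⟨j, rfl⟩)) _))

end Combine

section Torus

variable {Λ : Type*} [AddCommGroup Λ]

theorem tensor_eq_tmul (c : S.H1 ℝ ℝ) (x : Lie Λ) : S.tensor c x = S.tmul ℝ (Lie Λ) c x := rfl

theorem lattice_tmul (c : S.H1 ℤ ℤ) (x : Λ) :
    S.lattice Λ (S.tmul ℤ Λ c x) = S.tmul ℝ (Lie Λ) (S.integral c) (incl Λ x) := by
  obtain ⟨f, rfl⟩ := Submodule.mkQ_surjective _ c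
  change S.cls ℝ (Lie Λ) (S.mapCocycles (incl Λ) (S.mapCocycles _ f)) =
    S.cls ℝ (Lie Λ) (S.mapCocycles _ (S.mapCocycles _ f))
  congr 1
  ext s
  simp only [mapCocycles_apply, LinearMap.toSpanSingleton_apply]
  rw [map_smulₛₗ]
  rfl

theorem lattice_combine {ι : Type*} [Fintype ι] (c : ι → S.H1 ℤ ℤ) (x : ι → Λ) :
    S.lattice Λ (S.combine Λ c x) =
      S.combine (Lie Λ) (fun j => S.integral (c j)) (fun j => incl Λ (x j)) := by
  simp only [combine_apply, map_sum, lattice_tmul]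

variable [Fintype T]

theorem pairing_tmul {A : Type*} [AddCommGroup A] [Module ℝ A] (β : LinearMap.BilinForm ℝ A)
    (c d : S.H1 ℝ ℝ) (x y : A) :
    S.pairing β (S.tmul ℝ A c x) (S.tmul ℝ A d y) = S.cup c d * β x y := by
  obtain ⟨c, rfl⟩ := Submodule.mkQ_surjective _ c
  obtain ⟨d, rfl⟩ := Submodule.mkQ_surjective _ d
  change S.pairingCocycles β (S.mapCocycles _ c) (S.mapCocycles _ d) =
    S.pairingCocycles (LinearMap.mul ℝ ℝ) c d * β x y
  simp only [pairingCocycles_apply, mapCocycles_apply, LinearMap.toSpanSingleton_apply, map_smul,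
    LinearMap.smul_apply, smul_eq_mul, LinearMap.mul_apply', Finset.sum_mul]
  exact Finset.sum_congr rfl fun t _ => by ring

theorem pairing_combine {A : Type*} [AddCommGroup A] [Module ℝ A] (β : LinearMap.BilinForm ℝ A)
    {ι κ : Type*} [Fintype ι] [Fintype κ] (c : ι → S.H1 ℝ ℝ) (d : κ → S.H1 ℝ ℝ) (x : ι → A)
    (y : κ → A) : S.pairing β (S.combine A c x) (S.combine A d y) =
      ∑ i, ∑ j, S.cup (c i) (d j) * β (x i) (y j) := by
  simp only [combine_apply, map_sum, LinearMap.sum_apply, pairing_tmul]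
  exact Finset.sum_comm

namespace IsAdaptedBasis

variable {S} {L : Submodule ℝ (S.H1 ℝ ℝ)} {g : ℕ} {a b : Fin g → S.H1 ℤ ℤ}

theorem mem_polarization_iff (h : S.IsAdaptedBasis L a b) (v : S.H1 ℝ (Lie Λ)) :
    v ∈ S.polarization Λ L ↔ ∃ x, S.combine (Lie Λ) (fun j => S.integral (a j)) x = v := by
  constructor
  · intro hv
    suffices hle : S.polarization Λ L ≤
        LinearMap.range (S.combine (Lie Λ) (fun j => S.integral (a j))) from hle hv
    rw [polarization, Submodule.span_le]
    rintro _ ⟨c, hc, x, rfl⟩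
    rw [h.span_a] at hc
    exact S.tmul_mem_range_combine _ hc x
  · rintro ⟨x, rfl⟩
    rw [combine_apply]
    refine sum_mem fun j _ => Submodule.subset_span ⟨_, ?_, x j, rfl⟩
    rw [h.span_a]
    exact Submodule.subset_span ⟨j, rfl⟩

theorem combine_mem (h : S.IsAdaptedBasis L a b) (x : Fin g → Lie Λ) :
    S.combine (Lie Λ) (fun j => S.integral (a j)) x ∈ S.polarization Λ L :=
  (h.mem_polarization_iff _).2 ⟨x, rfl⟩

/-- The cup factors already vanish, so `β` is arbitrary. This covers `K` and also the nonsymmetric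
`B` in the sign of the canonical lift. -/
theorem pairing_eq_zero (h : S.IsAdaptedBasis L a b) (β : LinearMap.BilinForm ℝ (Lie Λ))
    {v w : S.H1 ℝ (Lie Λ)} (hv : v ∈ S.polarization Λ L) (hw : w ∈ S.polarization Λ L) :
    S.pairing β v w = 0 := by
  obtain ⟨x, rfl⟩ := (h.mem_polarization_iff v).1 hv
  obtain ⟨y, rfl⟩ := (h.mem_polarization_iff w).1 hw
  simp [pairing_combine, h.cup_a_a]

theorem pairing_b_a (h : S.IsAdaptedBasis L a b) (β : LinearMap.BilinForm ℝ (Lie Λ))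
    (x y : Fin g → Lie Λ) : S.pairing β (S.combine (Lie Λ) (fun j => S.integral (b j)) x)
      (S.combine (Lie Λ) (fun j => S.integral (a j)) y) = -∑ j, β (x j) (y j) := by
  simp [pairing_combine, h.cup_b_a]

theorem exists_real_combine [Module.Free ℤ Λ] [Module.Finite ℤ Λ] (h : S.IsAdaptedBasis L a b)
    (hg : S.HasGenus g) (v : S.H1 ℝ (Lie Λ)) : ∃ x y,
      v = S.combine (Lie Λ) (fun j => S.integral (a j)) x +
        S.combine (Lie Λ) (fun j => S.integral (b j)) y :=
  S.exists_eq_combine_add_combine (Module.finBasis ℝ (Lie Λ)) _ _ (h.exists_real_coords hg) v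

theorem exists_int_combine [Module.Free ℤ Λ] [Module.Finite ℤ Λ] (h : S.IsAdaptedBasis L a b)
    (l : S.H1 ℤ Λ) : ∃ x y, l = S.combine Λ a x + S.combine Λ b y :=
  S.exists_eq_combine_add_combine (Module.finBasis ℤ Λ) _ _ h.exists_int_coords l

end IsAdaptedBasis

end Torus

end Surface

/-! ### The real form and the order of the discriminant group -/

section Form

theorem incl_injective {Λ : Type*} [AddCommGroup Λ] {K : LinearMap.BilinForm ℤ Λ}
    (hK : K.Nondegenerate) :
    Function.Injective (incl Λ) := by
  rw [injective_iff_map_eq_zero]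
  intro x hx
  refine hK.1 x fun z => ?_
  have := realForm_incl K x z
  rw [hx, map_zero, LinearMap.zero_apply] at this
  exact_mod_cast this.symm

variable {Λ : Type*} [AddCommGroup Λ] [Module.Free ℤ Λ] [Module.Finite ℤ Λ]

theorem nondegenerate_realForm {K : LinearMap.BilinForm ℤ Λ} (hK : K.Nondegenerate) :
    (realForm K).Nondegenerate := by
  let e := Module.finBasis ℤ Λ
  rw [LinearMap.BilinForm.nondegenerate_iff_det_ne_zero (e.baseChange ℝ)]
  have h : LinearMap.BilinForm.toMatrix (e.baseChange ℝ) (realForm K) =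
      (Int.castRingHom ℝ).mapMatrix (LinearMap.BilinForm.toMatrix e K) := by
    ext i j
    simp [LinearMap.BilinForm.toMatrix_apply, realForm, LinearMap.BilinForm.baseChange_tmul]
  rw [h, ← RingHom.map_det, eq_intCast, Int.cast_ne_zero]
  exact (LinearMap.BilinForm.nondegenerate_iff_det_ne_zero e).1 hK

theorem lie_linearMap_ext {f f' : Lie Λ →ₗ[ℝ] ℝ} (h : ∀ x, f (incl Λ x) = f' (incl Λ x)) :
    f = f' :=
  ((Module.finBasis ℤ Λ).baseChange ℝ).ext fun i => by
    rw [Module.Basis.baseChange_apply]; exact h _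

theorem eq_of_realForm_eq {K : LinearMap.BilinForm ℤ Λ} (hK : K.Nondegenerate) {y y' : Lie Λ}
    (h : ∀ x, realForm K y (incl Λ x) = realForm K y' (incl Λ x)) : y = y' := by
  have h' := lie_linearMap_ext h
  rw [← sub_eq_zero]
  refine (nondegenerate_realForm hK).1 _ fun z => ?_
  rw [map_sub, h', sub_self, LinearMap.zero_apply]

theorem exists_realForm_eq {K : LinearMap.BilinForm ℤ Λ} (hK : K.Nondegenerate)
    (φ : Λ →ₗ[ℤ] ℝ) : ∃ y, ∀ x, realForm K y (incl Λ x) = φ x := by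
  refine ⟨((realForm K).toDual (nondegenerate_realForm hK)).symm (φ.liftBaseChange ℝ), fun x => ?_⟩
  rw [LinearMap.BilinForm.apply_toDual_symm_apply]
  simp [incl]

/-- Nondegeneracy embeds `Λ` in `Λ*`; in a basis and its dual this embedding is the Gram matrix up
to transposition, and the index of the image is the absolute determinant. -/
theorem card_discriminant {K : LinearMap.BilinForm ℤ Λ} (hK : K.Nondegenerate) {n : ℕ}
    (e : Module.Basis (Fin n) ℤ Λ) :
    Nat.card (Discriminant K) = (LinearMap.BilinForm.toMatrix e K).det.natAbs := by
  have hinj : Function.Injective K := by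
    rw [injective_iff_map_eq_zero]
    exact fun x hx => hK.1 x fun y => by rw [hx, LinearMap.zero_apply]
  have h := Submodule.natAbs_det_basis_change e.dualBasis (LinearMap.range K)
    (e.map (LinearEquiv.ofInjective K hinj))
  rw [← h, Module.Basis.det_apply, ← Matrix.det_transpose]
  congr 2
  ext i j
  simp [Module.Basis.toMatrix_apply, LinearMap.BilinForm.toMatrix_apply]

theorem finite_discriminant {K : LinearMap.BilinForm ℤ Λ} (hK : K.Nondegenerate) :
    Finite (Discriminant K) := by
  refine Nat.finite_of_card_ne_zero ?_
  rw [card_discriminant hK (Module.finBasis ℤ Λ), Int.natAbs_ne_zero]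
  exact (LinearMap.BilinForm.nondegenerate_iff_det_ne_zero _).1 hK

end Form

/-! ### Parallel transport and the holonomy criterion -/

theorem eq_mul_exp_of_hasDerivAt {F : ℝ → ℂ} {c : ℂ} (hF : ∀ r, HasDerivAt F (c * F r) r) (r : ℝ) :
    F r = F 0 * Complex.exp (c * r) := by
  have hE : ∀ r : ℝ, HasDerivAt (fun r : ℝ => Complex.exp (-(c * r)))
      (Complex.exp (-(c * r)) * -c) r := fun r => by
    have h1 : HasDerivAt (fun r : ℝ => -(c * (r : ℂ))) (-c) r := by
      have h0 : HasDerivAt (fun r : ℝ => (r : ℂ)) 1 r := Complex.ofRealCLM.hasDerivAt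
      exact (h0.const_mul c).neg.congr_deriv (by rw [mul_one])
    exact h1.cexp
  have hG : ∀ r : ℝ, HasDerivAt (fun r : ℝ => F r * Complex.exp (-(c * r))) 0 r := fun r =>
    ((hF r).mul (hE r)).congr_deriv (by ring)
  have h := is_const_of_deriv_eq_zero (fun r => (hG r).differentiableAt) (fun r => (hG r).deriv) r 0
  simp only [Complex.ofReal_zero, mul_zero, neg_zero, Complex.exp_zero, mul_one] at h
  rw [← h, mul_assoc, ← Complex.exp_add, neg_add_cancel, Complex.exp_zero, mul_one]

/-- Connection conditions are imposed at parameter `0` but at every base point; moving the base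
point turns them into a differential equation along the whole line. -/
theorem hasDerivAt_line {E : Type*} [AddCommGroup E] [Module ℝ E] {f : E → ℂ} {v w : E} {d : ℂ}
    {r : ℝ} (h : HasDerivAt (fun q : ℝ => f (v + r • w + q • w)) d 0) :
    HasDerivAt (fun q : ℝ => f (v + q • w)) d r := by
  rw [← sub_self r] at h
  have e : (fun q : ℝ => f (v + q • w)) = fun q => f (v + r • w + (q - r) • w) := by
    ext q
    rw [add_assoc, ← add_smul, add_sub_cancel]
  rw [e]
  exact h.comp_sub_const r r

namespace Surface

variable {T : Type*} (S : Surface T) {Λ : Type*} [AddCommGroup Λ]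

theorem leaf_surjective (L : Submodule ℝ (S.H1 ℝ ℝ)) :
    Function.Surjective (S.leaf (Λ := Λ) L) := fun ℓ => by
  obtain ⟨m, rfl⟩ := QuotientAddGroup.mk_surjective ℓ
  obtain ⟨v, rfl⟩ := QuotientAddGroup.mk_surjective m
  exact ⟨v, rfl⟩

theorem leaf_add (L : Submodule ℝ (S.H1 ℝ ℝ)) (v w : S.H1 ℝ (Lie Λ)) :
    S.leaf L (v + w) = S.leaf L v + S.leaf L w := rfl

theorem leaf_sub (L : Submodule ℝ (S.H1 ℝ ℝ)) (v w : S.H1 ℝ (Lie Λ)) :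
    S.leaf L (v - w) = S.leaf L v - S.leaf L w := rfl

theorem leaf_eq_zero_iff (L : Submodule ℝ (S.H1 ℝ ℝ)) (v : S.H1 ℝ (Lie Λ)) :
    S.leaf L v = 0 ↔ ∃ w ∈ S.polarization Λ L, ∃ l, v = w + S.lattice Λ l := by
  rw [leaf, QuotientAddGroup.eq_zero_iff, AddSubgroup.mem_map]
  constructor
  · rintro ⟨w, hw, h⟩
    obtain ⟨l, hl⟩ := (QuotientAddGroup.eq (s := (S.lattice Λ).toAddMonoidHom.range)).1 h
    exact ⟨w, hw, l, by
      change S.lattice Λ l = -w + v at hl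
      rw [hl, add_neg_cancel_left]⟩
  · rintro ⟨w, hw, l, rfl⟩
    refine ⟨w, hw, (QuotientAddGroup.eq (s := (S.lattice Λ).toAddMonoidHom.range)).2 ⟨l, ?_⟩⟩
    rw [neg_add_cancel_left]
    rfl

theorem leaf_eq_leaf_iff (L : Submodule ℝ (S.H1 ℝ ℝ)) (v v₀ : S.H1 ℝ (Lie Λ)) :
    S.leaf L v = S.leaf L v₀ ↔ ∃ w ∈ S.polarization Λ L, ∃ l, v = v₀ + w + S.lattice Λ l := by
  rw [← sub_eq_zero, ← leaf_sub, leaf_eq_zero_iff]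
  simp only [sub_eq_iff_eq_add', add_assoc]

variable [Fintype T]

theorem omega_flip {K B : LinearMap.BilinForm ℤ Λ} (hB : ∀ x y, K x y = B x y + B y x)
    (v w : S.H1 ℝ (Lie Λ)) : S.omega K v w = -S.omega K w v := by
  rw [S.omega_add_flip B K hB, S.omega_add_flip B K hB]; ring

/-- Parallel transport `exp(π i r)`. -/
def phase (r : ℝ) : ℂ := Complex.exp (Real.pi * Complex.I * r)

theorem phase_add (r q : ℝ) : phase (r + q) = phase r * phase q := by
  rw [phase, phase, phase, ← Complex.exp_add]; push_cast; ring_nf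

theorem phase_zero : phase 0 = 1 := by simp [phase]

theorem phase_ne_zero (r : ℝ) : phase r ≠ 0 := Complex.exp_ne_zero _

theorem phase_eq_one_iff (r : ℝ) : phase r = 1 ↔ ∃ n : ℤ, r = 2 * n := by
  rw [phase, Complex.exp_eq_one_iff]
  have hpi : (Real.pi : ℂ) ≠ 0 := Complex.ofReal_ne_zero.2 Real.pi_ne_zero
  refine exists_congr fun n => ?_
  constructor
  · intro h
    have : (r : ℂ) = 2 * n := by
      have h0 : (Real.pi * Complex.I : ℂ) ≠ 0 := mul_ne_zero hpi Complex.I_ne_zero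
      refine mul_left_cancel₀ h0 ?_
      rw [h]; ring
    exact_mod_cast this
  · rintro rfl
    push_cast; ring

namespace Prequantum

variable {S} {K : LinearMap.BilinForm ℤ Λ} (P : S.Prequantum K)

theorem mult_ne_zero (l : S.H1 ℤ Λ) (v : S.H1 ℝ (Lie Λ)) : P.mult l v ≠ 0 := fun h => by
  have := P.norm_mult l v
  rw [h, norm_zero] at this
  exact zero_ne_one this

/-- The change of the connection form under translation by `l` does not depend on the point, so the
multiplier solves a linear equation with constant coefficient. Every prequantum bundle thus has the
canonical dependence on `v`. -/
theorem mult_add_right (l : S.H1 ℤ Λ) (v w : S.H1 ℝ (Lie Λ)) :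
    P.mult l (v + w) = P.mult l v * phase (S.omega K (S.lattice Λ l) w) := by
  have h := eq_mul_exp_of_hasDerivAt (F := fun r : ℝ => P.mult l (v + r • w))
    (c := Real.pi * Complex.I * (S.omega K (S.lattice Λ l) w : ℝ)) (fun r => by
      refine (hasDerivAt_line (P.hasDerivAt_mult l (v + r • w) w)).congr_deriv ?_
      simp only [connection, map_add, LinearMap.add_apply]
      push_cast; ring) 1
  simpa [phase] using h

end Prequantum

/-- The loops in the leaf come from lattice vectors in the polarization. By isotropy, transport from
`v₀` along `w` is `phase (ω(v₀, w))`, and a constant section exists iff it matches the lift on these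
loops. -/
theorem leaf_mem_bohrSommerfeld_iff {K : LinearMap.BilinForm ℤ Λ} (P : S.Prequantum K) (L : Submodule ℝ (S.H1 ℝ ℝ))
    (hL : ∀ v ∈ S.polarization Λ L, ∀ w ∈ S.polarization Λ L, S.omega K v w = 0)
    (v₀ : S.H1 ℝ (Lie Λ)) :
    S.leaf L v₀ ∈ S.bohrSommerfeld P L ↔ ∀ l, S.lattice Λ l ∈ S.polarization Λ L →
      P.mult l v₀ = phase (S.omega K v₀ (S.lattice Λ l)) := by
  constructor
  · rintro ⟨s, hs⟩ l hl
    obtain ⟨h0, hequiv, -⟩ := hs v₀ rfl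
    have hleaf : ∀ r : ℝ, S.leaf L (v₀ + r • S.lattice Λ l) = S.leaf L v₀ := fun r =>
      (S.leaf_eq_leaf_iff L _ _).2 ⟨r • S.lattice Λ l, Submodule.smul_mem _ _ hl, 0, by simp⟩
    have h := eq_mul_exp_of_hasDerivAt (F := fun r : ℝ => s (v₀ + r • S.lattice Λ l))
      (c := Real.pi * Complex.I * (S.omega K v₀ (S.lattice Λ l) : ℝ)) (fun r => by
        refine (hasDerivAt_line ((hs _ (hleaf r)).2.2 _ hl)).congr_deriv ?_
        simp [connection, hL _ hl _ hl]) 1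
    simp only [one_smul, zero_smul, add_zero, Complex.ofReal_one, mul_one] at h
    rw [hequiv, mul_comm] at h
    exact mul_left_cancel₀ h0 h
  · intro h
    -- The section is transported from the value `1` at `v₀` and then moved by the lattice. A single
    -- `c` serves all decompositions of `v`: two of them differ by a lattice vector `k` in the
    -- polarization, where the hypothesis applies. Off the leaf the value is irrelevant.
    have hex : ∀ v, ∃ c : ℂ, S.leaf L v = S.leaf L v₀ →
        ∀ w ∈ S.polarization Λ L, ∀ l, v = v₀ + w + S.lattice Λ l →
          c = P.mult l (v₀ + w) * phase (S.omega K v₀ w) := by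
      intro v
      by_cases hv : S.leaf L v = S.leaf L v₀
      · obtain ⟨w, hw, l, hvl⟩ := (S.leaf_eq_leaf_iff L _ _).1 hv
        refine ⟨P.mult l (v₀ + w) * phase (S.omega K v₀ w), fun _ w' hw' l' hvl' => ?_⟩
        obtain ⟨k, rfl⟩ : ∃ k, l' = l + k := ⟨l' - l, by abel⟩
        have hk : w = w' + S.lattice Λ k := by
          rw [hvl, map_add] at hvl'
          have : w + S.lattice Λ l = w' + S.lattice Λ k + S.lattice Λ l := by
            rw [add_assoc, add_assoc] at hvl'
            rw [add_left_cancel hvl']; abel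
          exact add_right_cancel this
        have hkL : S.lattice Λ k ∈ S.polarization Λ L := by
          have := sub_mem hw hw'
          rwa [hk, add_sub_cancel_left] at this
        rw [P.mult_add, P.mult_add_right k, h k hkL, hL _ hkL _ hw', phase_zero, mul_one, hk,
          map_add, phase_add, add_assoc v₀]
        ring
      · exact ⟨0, fun hv' => absurd hv' hv⟩
    choose s hs using hex
    refine ⟨s, fun v hv => ?_⟩
    obtain ⟨w, hw, l, hvl⟩ := (S.leaf_eq_leaf_iff L _ _).1 hv
    have hsv := hs v hv w hw l hvl
    have hs0 : s v ≠ 0 := by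
      rw [hsv]; exact mul_ne_zero (P.mult_ne_zero _ _) (phase_ne_zero _)
    refine ⟨hs0, fun m => ?_, fun u hu => ?_⟩
    · have hv' : v + S.lattice Λ m = v₀ + w + S.lattice Λ (m + l) := by
        rw [hvl, map_add]; abel
      rw [hs _ ((S.leaf_eq_leaf_iff L _ _).2 ⟨w, hw, m + l, hv'⟩) w hw (m + l) hv', P.mult_add,
        hsv, ← hvl]
      ring
    · have hsu : ∀ r : ℝ, s (v + r • u) = s v * phase (r * S.omega K v u) := fun r => by
        have hru : w + r • u ∈ S.polarization Λ L := add_mem hw (Submodule.smul_mem _ _ hu)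
        have hv' : v + r • u = v₀ + (w + r • u) + S.lattice Λ l := by
          rw [hvl]; abel
        rw [hs _ ((S.leaf_eq_leaf_iff L _ _).2 ⟨_, hru, l, hv'⟩) _ hru l hv', hsv, ← add_assoc v₀,
          P.mult_add_right, hvl]
        simp only [map_add, map_smul, LinearMap.add_apply, smul_eq_mul, hL _ hw _ hu, add_zero,
          mul_add, phase_add]
        ring
      simp only [hsu]
      have h1 : HasDerivAt (fun r : ℝ => Real.pi * Complex.I * ((r * S.omega K v u : ℝ) : ℂ))
          (Real.pi * Complex.I * (S.omega K v u : ℝ)) 0 := by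
        have := ((hasDerivAt_id (0 : ℝ)).mul_const (S.omega K v u)).ofReal_comp.const_mul
          (Real.pi * Complex.I : ℂ)
        simpa using this
      refine (h1.cexp.const_mul (s v)).congr_deriv ?_
      simp only [connection, zero_mul, Complex.ofReal_zero, mul_zero, Complex.exp_zero, one_mul,
        neg_neg]
      ring

end Surface

/-! ### Torsors of translations and lifting of characters -/

/-- Transitivity supplies differences by choice; injectivity of `ρ` makes the choice forced. -/
theorem exists_addTorsor_of_injective {G A : Type*} [AddCommGroup G] [AddCommGroup A] (ρ : G →+ A)
    (hρ : Function.Injective ρ) (Y : Set A) (hne : Y.Nonempty)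
    (hadd : ∀ u, ∀ y ∈ Y, ρ u + y ∈ Y) (htrans : ∀ y ∈ Y, ∀ y' ∈ Y, ∃ u, y = ρ u + y') :
    ∃ _ : AddTorsor G Y, ∀ (u : G) (y : Y), ((u +ᵥ y : Y) : A) = ρ u + y := by
  choose d hd using fun p : Y × Y => htrans p.1 p.1.2 p.2 p.2.2
  exact ⟨{
    vadd := fun u y => ⟨ρ u + y, hadd u y y.2⟩
    zero_vadd := fun y => Subtype.ext (by change ρ 0 + (y : A) = y; rw [map_zero, zero_add])
    add_vadd := fun u u' y => Subtype.ext (by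
      change ρ (u + u') + (y : A) = ρ u + (ρ u' + y); rw [map_add, add_assoc])
    vsub := fun y y' => d (y, y')
    nonempty := hne.to_subtype
    vsub_vadd' := fun y y' => Subtype.ext (hd (y, y')).symm
    vadd_vsub' := fun u y => hρ (add_right_cancel
      (hd (⟨ρ u + y, hadd u y y.2⟩, y)).symm) }, fun _ _ => rfl⟩

theorem exists_dual_of_integral {N : Type*} [AddCommGroup N] (f : N → ℝ)
    (hadd : ∀ x y, f (x + y) = f x + f y) (hf : ∀ x, ∃ n : ℤ, f x = n) :
    ∃ u : Module.Dual ℤ N, ∀ x, (u x : ℝ) = f x := by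
  choose u hu using hf
  refine ⟨(AddMonoidHom.mk' u fun x y => ?_).toIntLinearMap, fun x => (hu x).symm⟩
  have := hadd x y
  rw [hu, hu, hu] at this
  exact_mod_cast this

/-- Unitary characters of a free abelian group of finite rank lift to real functionals. -/
theorem exists_lift_character {N : Type*} [AddCommGroup N] [Module.Free ℤ N] [Module.Finite ℤ N]
    (χ : N → ℂ) (hnorm : ∀ x, ‖χ x‖ = 1) (hadd : ∀ x y, χ (x + y) = χ x * χ y) :
    ∃ θ : N →ₗ[ℤ] ℝ, ∀ x, χ x = Surface.phase (2 * θ x) := by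
  let e := Module.finBasis ℤ N
  -- Freeness allows arguments to be chosen on a basis only. Since `phase r` is `exp(π i r)`, the
  -- character is the phase of `2θ`.
  let θ : N →ₗ[ℤ] ℝ := e.constr ℤ fun i => Complex.arg (χ (e i)) / (2 * Real.pi)
  have hne : ∀ x, χ x ≠ 0 := fun x h => by
    have := hnorm x
    rw [h, norm_zero] at this
    exact zero_ne_one this
  have h0 : χ 0 = 1 := by
    have := hadd 0 0
    rw [add_zero] at this
    exact (mul_eq_left₀ (hne 0)).1 this.symm
  let Z : AddSubgroup N :=
    { carrier := {x | χ x = Surface.phase (2 * θ x)}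
      zero_mem' := by simp [h0, Surface.phase_zero]
      add_mem' := fun {x y} hx hy => by
        change χ (x + y) = _
        rw [hadd, hx, hy, ← Surface.phase_add, map_add, mul_add]
      neg_mem' := fun {x} hx => by
        change χ (-x) = _
        have hx' : χ x = Surface.phase (2 * θ x) := hx
        refine mul_left_cancel₀ (hne x) ?_
        rw [← hadd, add_neg_cancel, h0, hx', ← Surface.phase_add, map_neg,
          mul_neg, add_neg_cancel, Surface.phase_zero] }
  have hZ : Submodule.span ℤ (Set.range e) ≤ AddSubgroup.toIntSubmodule Z := by
    rw [Submodule.span_le]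
    rintro _ ⟨i, rfl⟩
    change χ (e i) = Surface.phase (2 * θ (e i))
    have hθ : 2 * θ (e i) = Complex.arg (χ (e i)) / Real.pi := by
      simp only [θ, Module.Basis.constr_basis]
      field_simp
    have h := Complex.norm_mul_exp_arg_mul_I (χ (e i))
    rw [hnorm, Complex.ofReal_one, one_mul] at h
    conv_lhs => rw [← h]
    rw [hθ, Surface.phase]
    congr 1
    have hpi : (Real.pi : ℂ) ≠ 0 := Complex.ofReal_ne_zero.2 Real.pi_ne_zero
    push_cast
    field_simp
  refine ⟨θ, fun x => hZ ?_⟩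
  rw [e.span_eq]
  trivial

/-! ### The discriminant group acting on Bohr–Sommerfeld leaves -/

namespace Surface

variable {T : Type*} {S : Surface T} {Λ : Type*} [AddCommGroup Λ]
  [Module.Free ℤ Λ] [Module.Finite ℤ Λ] {g : ℕ} {K B : LinearMap.BilinForm ℤ Λ}

variable (K) in
/-- The element `K⁻¹ u` of the Lie algebra. -/
def formInv (hK : K.Nondegenerate) (u : Module.Dual ℤ Λ) : Lie Λ :=
  (exists_realForm_eq hK ((Algebra.linearMap ℤ ℝ) ∘ₗ u)).choose

theorem realForm_formInv (hK : K.Nondegenerate) (u : Module.Dual ℤ Λ) (x : Λ) :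
    realForm K (formInv K hK u) (incl Λ x) = u x :=
  (exists_realForm_eq hK ((Algebra.linearMap ℤ ℝ) ∘ₗ u)).choose_spec x

theorem eq_formInv (hK : K.Nondegenerate) {u : Module.Dual ℤ Λ} {y : Lie Λ}
    (h : ∀ x, realForm K y (incl Λ x) = u x) : y = formInv K hK u :=
  eq_of_realForm_eq hK fun x => by rw [h, realForm_formInv]

/-- The map `[u] ↦ [c ⊗ K⁻¹ u]` from the discriminant group to the group of leaves. -/
def discriminantToLeaf (L : Submodule ℝ (S.H1 ℝ ℝ)) (hK : K.Nondegenerate) (c : S.H1 ℤ ℤ) :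
    Discriminant K →ₗ[ℤ] S.Leaf Λ L :=
  Submodule.liftQ _ (AddMonoidHom.mk'
    (fun u => S.leaf L (S.tensor (S.integral c) (formInv K hK u))) (fun u u' => by
      have e : formInv K hK (u + u') = formInv K hK u + formInv K hK u' :=
        (eq_formInv hK fun x => by
          simp [realForm_formInv]).symm
      rw [e, ← leaf_add, tensor_eq_tmul, tensor_eq_tmul, tensor_eq_tmul, map_add])).toIntLinearMap
    (by
      rintro _ ⟨x, rfl⟩
      change S.leaf L (S.tensor (S.integral c) (formInv K hK (K x))) = 0
      rw [← eq_formInv hK (y := incl Λ x) fun z => realForm_incl K x z, tensor_eq_tmul,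
        ← lattice_tmul, leaf_eq_zero_iff]
      exact ⟨0, zero_mem _, _, (zero_add _).symm⟩)

/-- The map `([uⱼ]) ↦ [∑ⱼ cⱼ ⊗ K⁻¹ uⱼ]`. -/
def discriminantPiToLeaf (L : Submodule ℝ (S.H1 ℝ ℝ)) (hK : K.Nondegenerate)
    (c : Fin g → S.H1 ℤ ℤ) : (Fin g → Discriminant K) →+ S.Leaf Λ L :=
  ∑ j, (discriminantToLeaf L hK (c j)).toAddMonoidHom.comp (Pi.evalAddMonoidHom _ j)

theorem discriminantPiToLeaf_mk {L : Submodule ℝ (S.H1 ℝ ℝ)} (hK : K.Nondegenerate) (c : Fin g → S.H1 ℤ ℤ)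
    {u : Fin g → Module.Dual ℤ Λ} {y : Fin g → Lie Λ}
    (h : ∀ j x, realForm K (y j) (incl Λ x) = u j x) :
    discriminantPiToLeaf L hK c (fun j => Submodule.Quotient.mk (u j)) =
      S.leaf L (S.combine (Lie Λ) (fun j => S.integral (c j)) y) := by
  let leafHom : S.H1 ℝ (Lie Λ) →+ S.Leaf Λ L := AddMonoidHom.mk' (S.leaf L) (S.leaf_add L)
  change _ = leafHom _
  rw [discriminantPiToLeaf, AddMonoidHom.finsetSum_apply, combine_apply, map_sum]
  refine Finset.sum_congr rfl fun j _ => ?_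
  rw [eq_formInv hK (h j)]
  rfl

variable [Fintype T] {L : Submodule ℝ (S.H1 ℝ ℝ)} {a b : Fin g → S.H1 ℤ ℤ}

/-- The `b`-directions are transverse to `L ⊗ 𝔱`: pairing with `a_j ⊗ z` isolates `K(y_j, z)`, which
must vanish for all `z`. -/
theorem IsAdaptedBasis.eq_zero_of_combine_mem (h : S.IsAdaptedBasis L a b) (hK : K.Nondegenerate)
    {y : Fin g → Lie Λ}
    (hy : S.combine (Lie Λ) (fun j => S.integral (b j)) y ∈ S.polarization Λ L) : y = 0 := by
  classical
  ext1 j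
  refine (nondegenerate_realForm hK).1 _ fun z => ?_
  have h0 := h.pairing_eq_zero (realForm K) hy
    ((h.mem_polarization_iff _).2 ⟨Pi.single j z, rfl⟩)
  rw [h.pairing_b_a, neg_eq_zero, Finset.sum_eq_single j] at h0
  · simpa using h0
  · intro i _ hij
    rw [Pi.single_eq_of_ne hij, map_zero]
  · simp

theorem IsAdaptedBasis.lattice_mem_iff (h : S.IsAdaptedBasis L a b) (hK : K.Nondegenerate)
    (l : S.H1 ℤ Λ) : S.lattice Λ l ∈ S.polarization Λ L ↔ ∃ x, l = S.combine Λ a x := by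
  constructor
  · intro hl
    obtain ⟨x, y, rfl⟩ := h.exists_int_combine l
    rw [map_add, lattice_combine, lattice_combine] at hl
    have hy := h.eq_zero_of_combine_mem hK ((add_mem_cancel_left (h.combine_mem _)).1 hl)
    have hy' : y = 0 := funext fun j => incl_injective hK (by
      rw [congrFun hy j, Pi.zero_apply, Pi.zero_apply, map_zero])
    exact ⟨x, by rw [hy', map_zero, add_zero]⟩
  · rintro ⟨x, rfl⟩
    rw [lattice_combine]
    exact h.combine_mem _

theorem IsAdaptedBasis.leaf_mem_bohrSommerfeld_iff (h : S.IsAdaptedBasis L a b)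
    (hK : K.Nondegenerate) (P : S.Prequantum K) (v : S.H1 ℝ (Lie Λ)) :
    S.leaf L v ∈ S.bohrSommerfeld P L ↔ ∀ x, P.mult (S.combine Λ a x) v =
      phase (S.omega K v (S.lattice Λ (S.combine Λ a x))) := by
  rw [S.leaf_mem_bohrSommerfeld_iff P L fun v hv w hw => h.pairing_eq_zero _ hv hw]
  constructor
  · intro H x
    exact H _ ((h.lattice_mem_iff hK _).2 ⟨x, rfl⟩)
  · intro H l hl
    obtain ⟨x, rfl⟩ := (h.lattice_mem_iff hK _).1 hl
    exact H x

/-- The lift acquires the phase of `-r` and parallel transport the phase of `r`, with `r = ω(w, l)`.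
Equality means that `2r` is an even integer, so the two halves combine to integrality of `r`. -/
theorem IsAdaptedBasis.leaf_add_mem_bohrSommerfeld_iff (h : S.IsAdaptedBasis L a b)
    (hB : ∀ x y, K x y = B x y + B y x) (hK : K.Nondegenerate) (P : S.Prequantum K)
    {v : S.H1 ℝ (Lie Λ)} (hv : S.leaf L v ∈ S.bohrSommerfeld P L) (w : S.H1 ℝ (Lie Λ)) :
    S.leaf L (v + w) ∈ S.bohrSommerfeld P L ↔
      ∀ x, ∃ n : ℤ, S.omega K w (S.lattice Λ (S.combine Λ a x)) = n := by
  rw [h.leaf_mem_bohrSommerfeld_iff hK] at hv ⊢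
  refine forall_congr' fun x => ?_
  rw [P.mult_add_right, hv, map_add, LinearMap.add_apply, phase_add,
    mul_right_inj' (phase_ne_zero _), S.omega_flip hB _ w]
  generalize S.omega K w (S.lattice Λ (S.combine Λ a x)) = r
  have e : phase (-r) = phase r ↔ phase (2 * r) = 1 := by
    have h1 : phase (-r) * phase r = 1 := by rw [← phase_add, neg_add_cancel, phase_zero]
    have h2 : phase (2 * r) = phase r * phase r := by rw [two_mul, phase_add]
    rw [h2]
    constructor
    · intro h; rwa [h] at h1
    · intro h; exact mul_right_cancel₀ (phase_ne_zero r) (h1.trans h.symm)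
  rw [e, phase_eq_one_iff]
  simp

/-- On the isotropic `a`-lattice the multiplier at `0` is a genuine unitary character, and moving
the base point in the `b`-directions compensates for it. -/
theorem IsAdaptedBasis.bohrSommerfeld_nonempty (h : S.IsAdaptedBasis L a b)
    (hB : ∀ x y, K x y = B x y + B y x) (hK : K.Nondegenerate) (P : S.Prequantum K) :
    (S.bohrSommerfeld P L).Nonempty := by
  classical
  obtain ⟨θ, hθ⟩ := exists_lift_character (fun x : Fin g → Λ => P.mult (S.combine Λ a x) 0)
    (fun x => P.norm_mult _ _) (fun x y => by
      rw [map_add, P.mult_add, P.mult_add_right]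
      have h0 : S.omega K (S.lattice Λ (S.combine Λ a x)) (S.lattice Λ (S.combine Λ a y)) = 0 :=
        h.pairing_eq_zero _ ((h.lattice_mem_iff hK _).2 ⟨x, rfl⟩)
          ((h.lattice_mem_iff hK _).2 ⟨y, rfl⟩)
      rw [h0, phase_zero, mul_one])
  -- The sign offsets the one in `pairing_b_a`, so that `ω` becomes `θ`. The multiplier at the new
  -- point is then `phase (2θ - θ)`, matching the transport `phase θ`.
  choose y hy using fun j => exists_realForm_eq hK (-(θ ∘ₗ LinearMap.single ℤ (fun _ => Λ) j))
  refine ⟨S.leaf L (S.combine (Lie Λ) (fun j => S.integral (b j)) y),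
    (h.leaf_mem_bohrSommerfeld_iff hK P _).2 fun x => ?_⟩
  have hω : S.omega K (S.combine (Lie Λ) (fun j => S.integral (b j)) y)
      (S.lattice Λ (S.combine Λ a x)) = θ x := by
    rw [lattice_combine, omega, h.pairing_b_a]
    simp only [hy, LinearMap.neg_apply, Finset.sum_neg_distrib, neg_neg, LinearMap.comp_apply]
    rw [← map_sum]
    congr 1
    exact LinearMap.sum_single_apply _ x
  have h1 := P.mult_add_right (S.combine Λ a x) 0
    (S.combine (Lie Λ) (fun j => S.integral (b j)) y)
  rw [zero_add] at h1
  rw [h1, hθ, S.omega_flip hB, hω, ← phase_add]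
  congr 1
  ring

/-- If the translation is trivial, removing a lattice vector leaves `b`-components inside `L ⊗ 𝔱`.
Transversality forces `K⁻¹ u_j ∈ Λ`, that is `u_j ∈ KΛ`. -/
theorem IsAdaptedBasis.discriminantPiToLeaf_injective (h : S.IsAdaptedBasis L a b)
    (hK : K.Nondegenerate) : Function.Injective (discriminantPiToLeaf L hK b) := by
  rw [injective_iff_map_eq_zero]
  intro u hu
  choose u' hu' using fun j => Submodule.Quotient.mk_surjective _ (u j)
  obtain rfl : (fun j => Submodule.Quotient.mk (u' j)) = u := funext hu'
  rw [discriminantPiToLeaf_mk hK b (y := fun j => formInv K hK (u' j))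
    (fun j x => realForm_formInv hK _ _), leaf_eq_zero_iff] at hu
  obtain ⟨w, hw, l, hl⟩ := hu
  obtain ⟨x, y, rfl⟩ := h.exists_int_combine l
  rw [map_add, lattice_combine, lattice_combine, ← add_assoc, ← sub_eq_iff_eq_add,
    ← map_sub] at hl
  have h0 := h.eq_zero_of_combine_mem hK (hl ▸ add_mem hw (h.combine_mem _))
  ext1 j
  rw [Pi.zero_apply, Submodule.Quotient.mk_eq_zero]
  refine ⟨y j, LinearMap.ext fun z => ?_⟩
  have h1 : formInv K hK (u' j) = incl Λ (y j) := sub_eq_zero.1 (congrFun h0 j)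
  have h2 := realForm_formInv hK (u' j) z
  rw [h1, realForm_incl] at h2
  exact_mod_cast h2

theorem IsAdaptedBasis.exists_addTorsor (h : S.IsAdaptedBasis L a b) (hg : S.HasGenus g)
    (hB : ∀ x y, K x y = B x y + B y x) (hK : K.Nondegenerate) (P : S.Prequantum K) :
    ∃ _ : AddTorsor (Fin g → Discriminant K) (S.bohrSommerfeld P L),
      ∀ (u : Fin g → Discriminant K) (ℓ : S.bohrSommerfeld P L),
        ((u +ᵥ ℓ : S.bohrSommerfeld P L) : S.Leaf Λ L) = discriminantPiToLeaf L hK b u + ℓ := by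
  classical
  refine exists_addTorsor_of_injective _ (h.discriminantPiToLeaf_injective hK) _
    (h.bohrSommerfeld_nonempty hB hK P) (fun u ℓ hℓ => ?_) (fun ℓ hℓ ℓ' hℓ' => ?_)
  · choose u' hu' using fun j => Submodule.Quotient.mk_surjective _ (u j)
    obtain rfl : (fun j => Submodule.Quotient.mk (u' j)) = u := funext hu'
    obtain ⟨v, rfl⟩ := S.leaf_surjective L ℓ
    rw [discriminantPiToLeaf_mk hK b (y := fun j => formInv K hK (u' j))
      (fun j x => realForm_formInv hK _ _), add_comm, ← leaf_add,
      h.leaf_add_mem_bohrSommerfeld_iff hB hK P hℓ]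
    intro x
    refine ⟨-∑ j, u' j (x j), ?_⟩
    rw [lattice_combine, omega, h.pairing_b_a]
    simp [realForm_formInv]
  · obtain ⟨v, rfl⟩ := S.leaf_surjective L ℓ
    obtain ⟨v', rfl⟩ := S.leaf_surjective L ℓ'
    obtain ⟨w, rfl⟩ : ∃ w, v = v' + w := ⟨v - v', by abel⟩
    obtain ⟨x₀, y, hxy⟩ := h.exists_real_combine hg w
    rw [h.leaf_add_mem_bohrSommerfeld_iff hB hK P hℓ', hxy] at hℓ
    -- Testing integrality on the lattice vector `a_j ⊗ x` isolates one coordinate; the `a`-part of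
    -- the difference contributes nothing.
    have hint : ∀ j x, ∃ n : ℤ, realForm K (y j) (incl Λ x) = n := fun j x => by
      obtain ⟨n, hn⟩ := hℓ (Pi.single j x)
      refine ⟨-n, ?_⟩
      rw [map_add, LinearMap.add_apply, lattice_combine, omega,
        h.pairing_eq_zero _ (h.combine_mem _) (h.combine_mem _), zero_add, h.pairing_b_a,
        Finset.sum_eq_single j] at hn
      · rw [Pi.single_eq_same] at hn
        push_cast
        linarith
      · intro i _ hij
        rw [Pi.single_eq_of_ne hij, map_zero, map_zero]
      · simp
    choose u hu using fun j => exists_dual_of_integral (fun x => realForm K (y j) (incl Λ x))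
      (fun x x' => by rw [map_add, map_add]) (hint j)
    refine ⟨fun j => Submodule.Quotient.mk (u j), ?_⟩
    rw [discriminantPiToLeaf_mk hK b (fun j x => (hu j x).symm), hxy, leaf_add, leaf_add, add_comm]
    congr 1
    rw [add_eq_right, leaf_eq_zero_iff]
    exact ⟨_, h.combine_mem x₀, 0, by rw [map_zero, add_zero]⟩

end Surface

end ToralCS

end

/-! ### Assembly -/

theorem mainTheorem3 {T : Type*} [Fintype T] (S : ToralCS.Surface T) (g : ℕ)
    (hg : S.HasGenus g)
    {Λ : Type*} [AddCommGroup Λ] [Module.Free ℤ Λ] [Module.Finite ℤ Λ]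
    (K : LinearMap.BilinForm ℤ Λ) (hsymm : ∀ x y, K x y = K y x)
    (heven : ∀ x, Even (K x x)) (hnondeg : K.Nondegenerate)
    (L : Submodule ℝ (S.H1 ℝ ℝ)) (hrat : S.IsRational L) (hlag : S.IsLagrangian L) :
    -- there is a symplectic basis of integral cohomology adapted to `L`
    (∃ a b : Fin g → S.H1 ℤ ℤ, S.IsAdaptedBasis L a b) ∧
    (∀ P : S.Prequantum K,
      -- for each adapted basis, `G_K^g` acts simply transitively on the Bohr--Sommerfeld leaves,
      -- the class of `u` acting as the translation by `∑ b_j ⊗ K⁻¹ u_j`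
      (∀ a b : Fin g → S.H1 ℤ ℤ, S.IsAdaptedBasis L a b →
        ∃ ρ : (Fin g → ToralCS.Discriminant K) →+ S.Leaf Λ L,
          (∀ (u : Fin g → Module.Dual ℤ Λ) (y : Fin g → ToralCS.Lie Λ),
            (∀ j x, ToralCS.realForm K (y j) (ToralCS.incl Λ x) = u j x) →
            ρ (fun j => Submodule.Quotient.mk (u j)) =
              S.leaf L (∑ j, S.tensor (S.integral (b j)) (y j))) ∧
          ∃ _ : AddTorsor (Fin g → ToralCS.Discriminant K) (S.bohrSommerfeld P L),
            ∀ (u : Fin g → ToralCS.Discriminant K) (ℓ : S.bohrSommerfeld P L),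
              ((u +ᵥ ℓ : S.bohrSommerfeld P L) : S.Leaf Λ L) = ρ u + ℓ) ∧
      -- the number of Bohr--Sommerfeld leaves
      (S.bohrSommerfeld P L).Finite ∧
      (S.bohrSommerfeld P L).ncard = Nat.card (ToralCS.Discriminant K) ^ g ∧
      ∀ (n : ℕ) (e : Module.Basis (Fin n) ℤ Λ),
        ((S.bohrSommerfeld P L).ncard : ℤ) =
          |(LinearMap.BilinForm.toMatrix e K).det| ^ g) ∧
    -- for the canonical prequantum line bundle the leaf through the origin is Bohr--Sommerfeld
    S.leaf L 0 ∈ S.bohrSommerfeld (S.canonicalPrequantum K hsymm heven) L := by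
  obtain ⟨B, hB⟩ := ToralCS.exists_splitting K hsymm heven
  obtain ⟨a, b, hab⟩ := S.exists_isAdaptedBasis hg L hrat hlag
  refine ⟨⟨a, b, hab⟩, fun P => ?_, ?_⟩
  · have := ToralCS.finite_discriminant hnondeg
    obtain ⟨_, -⟩ := hab.exists_addTorsor hg hB hnondeg P
    obtain ⟨ℓ⟩ : Nonempty (S.bohrSommerfeld P L) := AddTorsor.nonempty
    let e : (Fin g → ToralCS.Discriminant K) ≃ S.bohrSommerfeld P L := Equiv.vaddConst ℓ
    have hcard : (S.bohrSommerfeld P L).ncard = Nat.card (ToralCS.Discriminant K) ^ g := by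
      rw [← Nat.card_coe_set_eq, ← Nat.card_congr e, Nat.card_fun, Nat.card_fin]
    refine ⟨fun a b h => ⟨ToralCS.Surface.discriminantPiToLeaf L hnondeg b, fun u y huy => ?_,
      h.exists_addTorsor hg hB hnondeg P⟩, @Set.toFinite _ _ (Finite.of_equiv _ e), hcard, ?_⟩
    · rw [ToralCS.Surface.discriminantPiToLeaf_mk hnondeg b huy,
        ToralCS.Surface.combine_apply]
      rfl
    · intro n e
      rw [hcard, ToralCS.card_discriminant hnondeg e, Nat.cast_pow, Int.natCast_natAbs]
  · rw [S.leaf_mem_bohrSommerfeld_iff _ L fun v hv w hw => hab.pairing_eq_zero _ hv hw]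
    intro l hl
    change Complex.exp _ = _
    -- The sign `ε(l)` is trivial on lattice vectors of the polarization, because the pairing
    -- defined by the splitting also vanishes there; at the origin the remaining phases are `1`.
    have h0 : S.omega (ToralCS.exists_splitting K hsymm heven).choose (S.lattice Λ l)
        (S.lattice Λ l) = 0 := hab.pairing_eq_zero _ hl hl
    rw [h0]
    simp [ToralCS.Surface.phase]
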